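/- Let $H$ be a complex Hilbert space (of any dimension), $d>1$ a natural number, $\chi\in H$ a unit vector and $c_1,\dots,c_d>0$. A CP map from a Hilbert space $X$ to a Hilbert space $K$ is a completely positive linear map from the trace-class operators on $X$ to the trace-class operators on $K$. Call $(\nu,\psi_1,\dots,\psi_d)$ an admissible input if $\nu=\sum_{i=1}^d\alpha_i|i\rangle\in\mathbb C^d$ and $\psi_1,\dots,\psi_d\in H$ are unit vectors with $\mathrm{tr}(P_\chi P_{\psi_i})=|\langle\chi|\psi_i\rangle|^2=c_i$ for all $i$, where $P_\psi=|\psi\rangle\langle\psi|$, and for such an input put $$|\Psi_d\rangle=\sum_{i=1}^d\alpha_i\,\frac{\prod_{k\ne i}\langle\chi|\psi_k\rangle}{\prod_{k\ne i}|\langle\chi|\psi_k\rangle|}\,|\psi_i\rangle .$$ (Existence.) There is a CP map $\Lambda^d_{\sup}$ from $\mathbb C^d\otimes H^{\otimes d}$ to $H$ and a constant $r>0$ such that for all admissible inputs $$\Lambda^d_{\sup}\Bigl(P_\nu\otimes\bigotimes_{i=1}^dP_{\psi_i}\Bigr)=r\,|\Psi_d\rangle\langle\Psi_d| .$$ Such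 a map is $\Lambda^d_{\sup}(\rho)=\mathrm{tr}_{1,3,\dots,d+1}(V\rho V^\dagger)$ with $V=V_3V_2V_1$, $V_1=\sum_{i}|i\rangle\langle i|\otimes S_{1,i}$, $V_2=I_d\otimes I\otimes(|\chi\rangle\langle\chi|)^{\otimes(d-1)}$ and $V_3=P_{\mu_d}\otimes I^{\otimes d}$. Here $S_{1,i}$ exchanges the first and the $i$-th copy of $H$, $\mu_d$ is the unit vector positively proportional to $\sum_i\bigl(\prod_{k\ne i}\sqrt{c_k}\bigr)^{-1}|i\rangle$, and the partial trace is over all factors of $\mathbb C^d\otimes H\otimes H^{\otimes(d-1)}$ except the second. (Uniqueness.) Suppose moreover that $\dim H\ge2$ and $c_i<1$ for all $i$. If $\Lambda$ is any CP map from $\mathbb C^d\otimes H^{\otimes d}$ to $H$ such that for every admissible input $\Lambda\bigl(P_\nu\otimes\bigotimes_iP_{\psi_i}\bigr)$ is a scalar multiple of $|\Psi_d\rangle\langle\Psi_d|$ (the scalar may be zero and may depend on the input), then $\Lambda=s\,\Lambda^d_{\sup}$ for some $s\ge0$. -/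

import Mathlib

open scoped BigOperators ComplexOrder InnerProductSpace

noncomputable section

namespace Superposition

/-! ### Trace-class operators and completely positive maps -/

section General

variable {X : Type*} [NormedAddCommGroup X] [InnerProductSpace ℂ X]
variable {K : Type*} [NormedAddCommGroup K] [InnerProductSpace ℂ K]

/-- Merging two sequences into one: the first on the even numbers, the second on the odd ones. -/
def interleave {A : Type*} (f g : ℕ → A) (k : ℕ) : A :=
  Sum.elim f g (Equiv.natSumNatEquivNat.symm k)

theorem hasSum_interleave {A : Type*} [AddCommMonoid A] [TopologicalSpace A] [ContinuousAdd A]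
    {u : ℕ → A} {F G : ℕ → A} {a b : A}
    (hu : ∀ k, u k = Sum.elim F G (Equiv.natSumNatEquivNat.symm k))
    (hF : HasSum F a) (hG : HasSum G b) : HasSum u (a + b) := by
  have h : HasSum (Sum.elim F G) (a + b) := by
    refine HasSum.sum ?_ ?_
    · simpa [Function.comp_def] using hF
    · simpa [Function.comp_def] using hG
  have h2 := (Equiv.hasSum_iff Equiv.natSumNatEquivNat.symm).mpr h
  have : u = Sum.elim F G ∘ Equiv.natSumNatEquivNat.symm := funext hu
  rw [this]
  exact h2

variable (X) in
/-- The space of trace-class (equivalently, nuclear) operators on a Hilbert space: the operators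
`∑ₙ |xₙ⟩⟨yₙ|` with `∑ₙ ‖xₙ‖ ‖yₙ‖ < ∞`. When `X` is finite-dimensional these are all operators. -/
def TraceClass : Submodule ℂ (X →L[ℂ] X) where
  carrier := {T | ∃ x y : ℕ → X, Summable (fun k => ‖x k‖ * ‖y k‖) ∧
    HasSum (fun k => InnerProductSpace.rankOne ℂ (x k) (y k)) T}
  zero_mem' := ⟨0, 0, by simp, by simp⟩
  add_mem' := by
    rintro S T ⟨x, y, h1, h2⟩ ⟨x', y', h1', h2'⟩
    refine ⟨interleave x x', interleave y y', ?_, ?_⟩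
    · refine (hasSum_interleave ?_ h1.hasSum h1'.hasSum).summable
      intro k
      unfold interleave
      cases Equiv.natSumNatEquivNat.symm k <;> rfl
    · refine hasSum_interleave ?_ h2 h2'
      intro k
      unfold interleave
      cases Equiv.natSumNatEquivNat.symm k <;> rfl
  smul_mem' := by
    rintro a T ⟨x, y, h1, h2⟩
    refine ⟨fun k => a • x k, y, ?_, ?_⟩
    · simpa [norm_smul, mul_assoc] using h1.mul_left ‖a‖
    · simpa using h2.const_smul a

/-- The operator `|x⟩⟨x|`; for a unit vector `x` this is the pure state represented by `x`. -/
def ketbra (x : X) : TraceClass X :=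
  ⟨InnerProductSpace.rankOne ℂ x x, by
    refine ⟨Pi.single 0 x, Pi.single 0 x, ?_, ?_⟩
    · refine summable_of_ne_finset_zero (s := {0}) fun k hk => ?_
      have hk0 : k ≠ 0 := by simpa using hk
      simp [Pi.single_eq_of_ne hk0]
    · have h := hasSum_single (f := fun k => InnerProductSpace.rankOne ℂ
        ((Pi.single 0 x : ℕ → X) k) ((Pi.single 0 x : ℕ → X) k)) 0
        (fun k hk => by simp [Pi.single_eq_of_ne hk])
      simpa using h⟩

/-- A block operator `(T i j)` on `X ⊕ ⋯ ⊕ X` is positive. -/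
def BlockPositive {m : ℕ} (T : Fin m → Fin m → TraceClass X) : Prop :=
  ∀ x : Fin m → X, 0 ≤ ∑ i, ∑ j, ⟪x i, (T i j : X →L[ℂ] X) (x j)⟫_ℂ

/-- Complete positivity of a linear map between spaces of trace-class operators: all the
amplifications `id ⊗ Λ` to `m × m` block operators preserve positivity. -/
def IsCP (Λ : TraceClass X →ₗ[ℂ] TraceClass K) : Prop :=
  ∀ (m : ℕ) (T : Fin m → Fin m → TraceClass X),
    BlockPositive T → BlockPositive fun i j => Λ (T i j)

end General

/-! ### The Hilbert space `ℂᵈ ⊗ H ⊗ ⋯ ⊗ H` with `d = n + 1` copies of `H` -/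

section Tensor

variable {H : Type*} [NormedAddCommGroup H] [InnerProductSpace ℂ H] {ι : Type*}

/-- The Hilbert space `ℂᵈ ⊗ H^{⊗ d}`, `d = n + 1`, for a Hilbert space `H` with orthonormal basis
indexed by `ι`, in coordinates: square-summable families indexed by the product basis. -/
abbrev Space (ι : Type*) (n : ℕ) : Type _ :=
  lp (fun _ : Fin (n + 1) × (Fin (n + 1) → ι) => ℂ) 2

theorem summable_prod_pi : ∀ (m : ℕ) (g : Fin m → ι → ℝ), (∀ k j, 0 ≤ g k j) →
    (∀ k, Summable (g k)) → Summable fun f : Fin m → ι => ∏ k, g k (f k)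
  | 0, _, _, _ => (hasSum_fintype _).summable
  | m + 1, g, h0, hs => by
    have ih := summable_prod_pi m (fun k => g k.succ) (fun k j => h0 _ j) (fun k => hs _)
    have h := (hs 0).mul_of_nonneg ih (fun j => h0 0 j)
      (fun f => Finset.prod_nonneg fun k _ => h0 _ _)
    rw [← (Fin.consEquiv (fun _ : Fin (m + 1) => ι)).summable_iff]
    refine h.congr fun p => ?_
    simp [Fin.prod_univ_succ, Fin.consEquiv]

/-- The product vector `|ν⟩ ⊗ |ψ₁⟩ ⊗ ⋯ ⊗ |ψ_d⟩`: its coordinates with respect to the product basis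
are the products of the coordinates of the factors. -/
def pureTensor (b : HilbertBasis ι ℂ H) {n : ℕ} (ν : EuclideanSpace ℂ (Fin (n + 1)))
    (ψ : Fin (n + 1) → H) : Space ι n :=
  ⟨fun p => ν p.1 * ∏ k, b.repr (ψ k) (p.2 k), by
    refine memℓp_gen ?_
    have h1 : ∀ k, Summable fun j => ‖b.repr (ψ k) j‖ ^ 2 := fun k => by
      simpa using (lp.memℓp (b.repr (ψ k))).summable (by simp)
    have h2 := summable_prod_pi (n + 1) (fun k j => ‖b.repr (ψ k) j‖ ^ 2)
      (fun _ _ => by positivity) h1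
    have h3 : Summable fun i => ‖ν i‖ ^ 2 := (hasSum_fintype _).summable
    have h4 := h3.mul_of_nonneg h2 (fun _ => by positivity)
      (fun _ => Finset.prod_nonneg fun _ _ => by positivity)
    refine h4.congr fun p => ?_
    simp [mul_pow, Finset.prod_pow, norm_prod]⟩

/-- The bijection of the product basis underlying the controlled swap: when the qudit is in the
basis state `i`, exchange the first and the `i`-th index. -/
def swapIndex (ι : Type*) (n : ℕ) :
    (Fin (n + 1) × (Fin (n + 1) → ι)) ≃ (Fin (n + 1) × (Fin (n + 1) → ι)) where
  toFun p := (p.1, p.2 ∘ Equiv.swap 0 p.1)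
  invFun p := (p.1, p.2 ∘ Equiv.swap 0 p.1)
  left_inv p := by ext <;> simp
  right_inv p := by ext <;> simp

theorem summable_swapIndex {n : ℕ} (f : Space ι n) :
    Summable fun p => ‖f (swapIndex ι n p)‖ ^ 2 := by
  have h : Summable fun p => ‖f p‖ ^ 2 := by
    simpa using (lp.memℓp f).summable (by simp)
  exact (swapIndex ι n).summable_iff.mpr h

/-- The controlled swap `∑ᵢ |i⟩⟨i| ⊗ S_{1,i}`, where `S_{1,i}` exchanges the first and the `i`-th
copy of `H`. -/
def controlledSwap (ι : Type*) (n : ℕ) : Space ι n →L[ℂ] Space ι n :=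
  LinearMap.mkContinuous
    { toFun := fun f => ⟨fun p => f (swapIndex ι n p),
        memℓp_gen (by simpa using summable_swapIndex f)⟩
      map_add' := fun f g => by ext p; rfl
      map_smul' := fun a f => by ext p; rfl } 1 (fun f => by
        rw [one_mul, lp.norm_eq_tsum_rpow (by simp), lp.norm_eq_tsum_rpow (by simp)]
        exact le_of_eq (congrArg (· ^ _)
          ((swapIndex ι n).tsum_eq fun p => ‖f p‖ ^ (2 : ENNReal).toReal)))

/-- The projection `𝕀_d ⊗ 𝕀 ⊗ (|χ⟩⟨χ|)^{⊗ (d-1)}`, that is, the orthogonal projection onto the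
closed subspace `ℂᵈ ⊗ H ⊗ ℂχ ⊗ ⋯ ⊗ ℂχ`. -/
def referenceProj (b : HilbertBasis ι ℂ H) (n : ℕ) (χ : H) : Space ι n →L[ℂ] Space ι n :=
  (Submodule.span ℂ {v | ∃ (ν : EuclideanSpace ℂ (Fin (n + 1))) (h : H),
    v = pureTensor b ν (Fin.cons h fun _ => χ)}).topologicalClosure.starProjection

/-- The normalized qudit vector `|μ_d⟩ ∝ ∑ᵢ (∏_{k ≠ i} √c_k)⁻¹ |i⟩`. -/
def muVec {n : ℕ} (c : Fin (n + 1) → ℝ) : EuclideanSpace ℂ (Fin (n + 1)) :=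
  let u : EuclideanSpace ℂ (Fin (n + 1)) :=
    WithLp.toLp 2 fun i => ((∏ k ∈ Finset.univ.erase i, √(c k))⁻¹ : ℝ)
  ((‖u‖⁻¹ : ℝ) : ℂ) • u

/-- The projection `P_μ ⊗ 𝕀^{⊗ d}` for a unit vector `μ`, that is, the orthogonal projection onto
the closed subspace `ℂμ ⊗ H ⊗ ⋯ ⊗ H`. -/
def quditProj (b : HilbertBasis ι ℂ H) {n : ℕ} (μ : EuclideanSpace ℂ (Fin (n + 1))) :
    Space ι n →L[ℂ] Space ι n :=
  (Submodule.span ℂ {v | ∃ ψ : Fin (n + 1) → H,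
    v = pureTensor b μ ψ}).topologicalClosure.starProjection

/-- `S` is the partial trace of `T` over all the factors of `ℂᵈ ⊗ H ⊗ H^{⊗ (d-1)}` except for the
first copy of `H`. -/
def IsPartialTrace (b : HilbertBasis ι ℂ H) {n : ℕ} (T : Space ι n →L[ℂ] Space ι n)
    (S : H →L[ℂ] H) : Prop :=
  ∀ x y : H, HasSum (fun p : Fin (n + 1) × (Fin n → ι) =>
    ⟪pureTensor b (EuclideanSpace.single p.1 1) (Fin.cons x fun k => b (p.2 k)),
      T (pureTensor b (EuclideanSpace.single p.1 1) (Fin.cons y fun k => b (p.2 k)))⟫_ℂ)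
    ⟪x, S y⟫_ℂ

/-- `Λ = Λ₄ ∘ Λ₃ ∘ Λ₂ ∘ Λ₁`: controlled swap, projection of the last `d - 1` copies of `H` onto `χ`,
projection of the qudit onto `μ_d`, and partial trace onto the first copy of `H`. -/
def IsProtocol (b : HilbertBasis ι ℂ H) {n : ℕ} (χ : H) (c : Fin (n + 1) → ℝ)
    (Λ : TraceClass (Space ι n) →ₗ[ℂ] TraceClass H) : Prop :=
  let V : Space ι n →L[ℂ] Space ι n :=
    quditProj b (muVec c) ∘L referenceProj b n χ ∘L controlledSwap ι n
  ∀ T : TraceClass (Space ι n),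
    IsPartialTrace b (V ∘L (T : Space ι n →L[ℂ] Space ι n) ∘L ContinuousLinearMap.adjoint V)
      (Λ T : H →L[ℂ] H)

/-- The superposition `|Ψ_d⟩ = ∑ᵢ αᵢ (∏_{k ≠ i} ⟨χ|ψ_k⟩ / ∏_{k ≠ i} |⟨χ|ψ_k⟩|) |ψᵢ⟩`. -/
def superposition {n : ℕ} (χ : H) (α : EuclideanSpace ℂ (Fin (n + 1)))
    (ψ : Fin (n + 1) → H) : H :=
  ∑ i, (α i * ((∏ k ∈ Finset.univ.erase i, ⟪χ, ψ k⟫_ℂ) /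
    ((∏ k ∈ Finset.univ.erase i, ‖⟪χ, ψ k⟫_ℂ‖ : ℝ) : ℂ))) • ψ i

/-- The admissible inputs: a qudit state `ν = ∑ᵢ αᵢ |i⟩` and pure states `ψᵢ` with
`tr (P_χ P_{ψᵢ}) = |⟨χ|ψᵢ⟩|² = cᵢ`. -/
def IsInput {n : ℕ} (χ : H) (c : Fin (n + 1) → ℝ) (α : EuclideanSpace ℂ (Fin (n + 1)))
    (ψ : Fin (n + 1) → H) : Prop :=
  ‖α‖ = 1 ∧ ∀ i, ‖ψ i‖ = 1 ∧ ‖⟪χ, ψ i⟫_ℂ‖ ^ 2 = c i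

end Tensor

end Superposition

end

/-! Existence. With `J h = μ ⊗ h ⊗ χ ⊗ ⋯ ⊗ χ` (`attach`), the two projections of the protocol
compose to `J J†`. Since `μ` and `χ` are unit vectors, tracing out the other factors undoes
conjugation by `J`. The protocol is therefore `T ↦ A T A†` with the single operator `A = J† ∘
controlledSwap` (`contraction`), and complete positivity is immediate. On `|i⟩ ⊗ ψ` the operator `A`
gives `μ_i ∏_{k ≠ i} ⟨χ|ψ_k⟩ ψ_i`; the weights of `muVec` supply the missing denominators, so that
`A` sends an admissible product vector to a fixed multiple of the superposition.

Uniqueness. No Kraus decomposition is used. Complete positivity gives a Cauchy–Schwarz inequality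
for `⟨h|Λ(|x⟩⟨y|)|h'⟩` (`IsCP.normSq_inner_le`). Hence, for fixed `y` and `h'`, the linear map `M :
x ↦ Λ(|x⟩⟨y|) h'` also sends each admissible product vector to a multiple of the superposition.
`multilinear_superposition` shows that such an `M` agrees with a multiple of `A` on product vectors.
Positive functionals on trace-class operators are automatically bounded
(`IsPositiveFunctional.exists_bound`), so `M` is weakly continuous and the agreement extends to all
`x`. Hermitian symmetry then fixes the dependence on `y` and `h'` up to one nonnegative scalar
(`IsCP.eq_smul_conjugation`), and countable additivity passes from rank-one operators to all
trace-class ones.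

The multilinear core works with vectors `χ + ξ`, where `ξ ⟂ χ` has prescribed norm. All overlaps
with `χ` are then 1, the phase factors disappear, and these vectors still span `H`. -/

namespace Superposition

/-! ### Product vectors, the controlled swap and the projections of the protocol. -/

section TensorCalculus

variable {H : Type*} [NormedAddCommGroup H] [InnerProductSpace ℂ H] {ι : Type*} {n : ℕ}

theorem hasSum_of_eq {A B : Type*} [AddCommMonoid B] [TopologicalSpace B] {f g : A → B} {a : B}
    (hg : HasSum g a) (h : ∀ p, f p = g p) : HasSum f a := by
  rwa [funext h]

theorem hasSum_mul_prod {A B : Type*} {f : A → ℂ} {g : B → ℂ} {a b : ℂ} (hf : HasSum f a)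
    (hg : HasSum g b) : HasSum (fun p : A × B => f p.1 * g p.2) (a * b) :=
  hf.mul hg (summable_mul_of_summable_norm hf.summable.norm hg.summable.norm)

theorem hasSum_prod_pi : ∀ (m : ℕ) (g : Fin m → ι → ℂ) (a : Fin m → ℂ),
    (∀ k, HasSum (g k) (a k)) → HasSum (fun f : Fin m → ι => ∏ k, g k (f k)) (∏ k, a k)
  | 0, _, _, _ => by
    simp
  | m + 1, g, a, h => by
    have ih := hasSum_prod_pi m (fun k => g k.succ) (fun k => a k.succ) (fun k => h _)
    have h2 := hasSum_mul_prod (h 0) ih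
    rw [← (Fin.consEquiv (fun _ : Fin (m + 1) => ι)).hasSum_iff, Fin.prod_univ_succ]
    refine hasSum_of_eq h2 fun p => ?_
    simp [Fin.prod_univ_succ, Fin.consEquiv]

theorem pureTensor_apply (b : HilbertBasis ι ℂ H) (ν : EuclideanSpace ℂ (Fin (n + 1)))
    (ψ : Fin (n + 1) → H) (p : Fin (n + 1) × (Fin (n + 1) → ι)) :
    pureTensor b ν ψ p = ν p.1 * ∏ k, b.repr (ψ k) (p.2 k) := rfl

theorem inner_pureTensor (b : HilbertBasis ι ℂ H) (ν ν' : EuclideanSpace ℂ (Fin (n + 1)))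
    (ψ ψ' : Fin (n + 1) → H) :
    ⟪pureTensor b ν ψ, pureTensor b ν' ψ'⟫_ℂ = ⟪ν, ν'⟫_ℂ * ∏ k, ⟪ψ k, ψ' k⟫_ℂ := by
  have h1 : HasSum (fun i => ⟪ν i, ν' i⟫_ℂ) ⟪ν, ν'⟫_ℂ := by
    rw [PiLp.inner_apply]; exact hasSum_fintype _
  have h2 : ∀ k, HasSum (fun j => ⟪b.repr (ψ k) j, b.repr (ψ' k) j⟫_ℂ) ⟪ψ k, ψ' k⟫_ℂ := by
    intro k
    rw [← b.repr.inner_map_map]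
    exact lp.hasSum_inner _ _
  have h4 := hasSum_mul_prod h1 (hasSum_prod_pi (n + 1) _ _ h2)
  refine (lp.hasSum_inner (pureTensor b ν ψ) (pureTensor b ν' ψ')).unique ?_
  refine hasSum_of_eq h4 fun p => ?_
  simp only [pureTensor_apply, RCLike.inner_apply, map_mul, map_prod, Finset.prod_mul_distrib]
  ring

/-- The product vector as a multilinear function of the factors in `H`. -/
noncomputable def pureTensorMultilinear (b : HilbertBasis ι ℂ H)
    (ν : EuclideanSpace ℂ (Fin (n + 1))) :
    MultilinearMap ℂ (fun _ : Fin (n + 1) => H) (Space ι n) where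
  toFun := pureTensor b ν
  map_update_add' := by
    intro _ ψ i x y
    ext p
    have : ∀ z, ∏ k, b.repr (Function.update ψ i z k) (p.2 k)
        = b.repr z (p.2 i) * ∏ k ∈ Finset.univ.erase i, b.repr (ψ k) (p.2 k) := by
      intro z
      rw [← Finset.mul_prod_erase _ _ (Finset.mem_univ i)]
      congr 1
      · simp
      · refine Finset.prod_congr rfl fun k hk => ?_
        rw [Function.update_of_ne (Finset.ne_of_mem_erase hk)]
    simp only [lp.coeFn_add, Pi.add_apply, pureTensor_apply]
    convert_to ν p.1 * ∏ k, b.repr (Function.update ψ i (x + y) k) (p.2 k) =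
      ν p.1 * (∏ k, b.repr (Function.update ψ i x k) (p.2 k))
      + ν p.1 * (∏ k, b.repr (Function.update ψ i y k) (p.2 k)) using 6
    rw [this, this, this]
    simp only [map_add, lp.coeFn_add, Pi.add_apply]
    ring
  map_update_smul' := by
    intro _ ψ i a x
    ext p
    have : ∀ z, ∏ k, b.repr (Function.update ψ i z k) (p.2 k)
        = b.repr z (p.2 i) * ∏ k ∈ Finset.univ.erase i, b.repr (ψ k) (p.2 k) := by
      intro z
      rw [← Finset.mul_prod_erase _ _ (Finset.mem_univ i)]
      congr 1
      · simp
      · refine Finset.prod_congr rfl fun k hk => ?_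
        rw [Function.update_of_ne (Finset.ne_of_mem_erase hk)]
    simp only [lp.coeFn_smul, Pi.smul_apply, pureTensor_apply]
    convert_to ν p.1 * ∏ k, b.repr (Function.update ψ i (a • x) k) (p.2 k) =
      a • (ν p.1 * (∏ k, b.repr (Function.update ψ i x k) (p.2 k))) using 6
    rw [this, this]
    simp only [map_smul, lp.coeFn_smul, Pi.smul_apply, smul_eq_mul]
    ring

theorem pureTensorMultilinear_apply (b : HilbertBasis ι ℂ H)
    (ν : EuclideanSpace ℂ (Fin (n + 1))) (ψ : Fin (n + 1) → H) :
    pureTensorMultilinear b ν ψ = pureTensor b ν ψ := rfl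

theorem pureTensor_eq_sum (b : HilbertBasis ι ℂ H) (ν : EuclideanSpace ℂ (Fin (n + 1)))
    (ψ : Fin (n + 1) → H) :
    pureTensor b ν ψ = ∑ i, ν i • pureTensor b (EuclideanSpace.single i 1) ψ := by
  ext p
  rw [lp.coeFn_sum, Finset.sum_apply, pureTensor_apply]
  simp [pureTensor_apply]

theorem pureTensor_smul (b : HilbertBasis ι ℂ H) (a : ℂ) (ν : EuclideanSpace ℂ (Fin (n + 1)))
    (ψ : Fin (n + 1) → H) :
    pureTensor b (a • ν) ψ = a • pureTensor b ν ψ := by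
  ext p
  simp [pureTensor_apply, mul_assoc]

theorem pureTensor_smul_factors (b : HilbertBasis ι ℂ H) (a : Fin (n + 1) → ℂ)
    (ν : EuclideanSpace ℂ (Fin (n + 1))) (ψ : Fin (n + 1) → H) :
    pureTensor b ν (fun k => a k • ψ k) = (∏ k, a k) • pureTensor b ν ψ :=
  (pureTensorMultilinear b ν).map_smul_univ a ψ

/-- Two continuous linear functionals on the tensor product agree if they agree on pure tensors. -/
theorem ext_pureTensor (b : HilbertBasis ι ℂ H) {E : Type*} [AddCommMonoid E]
    [TopologicalSpace E] [T2Space E] [Module ℂ E] {f g : Space ι n →L[ℂ] E}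
    (h : ∀ i ψ, f (pureTensor b (EuclideanSpace.single i 1) ψ)
      = g (pureTensor b (EuclideanSpace.single i 1) ψ)) : f = g := by
  classical
  ext v
  have hv := lp.hasSum_single (p := 2) (by simp) v
  refine (hv.mapL f).unique (hasSum_of_eq (hv.mapL g) fun p => ?_)
  -- The coordinate basis vectors are themselves product vectors, so the basis expansion of `v`
  -- reduces the claim to these.
  have hp : lp.single 2 p (v p)
      = v p • pureTensor b (EuclideanSpace.single p.1 1) (fun k => b (p.2 k)) := by
    ext q
    have h1 : ∏ k, b.repr (b (p.2 k)) (q.2 k) = if q.2 = p.2 then 1 else 0 := by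
      simp only [HilbertBasis.repr_self, lp.single_apply, Pi.single_apply]
      rw [Finset.prod_ite_zero]
      simp [funext_iff]
    rw [lp.coeFn_smul, Pi.smul_apply, pureTensor_apply, h1, lp.single_apply]
    by_cases hq : q = p
    · subst hq; simp
    · rw [Pi.single_eq_of_ne hq]
      by_cases hq1 : q.1 = p.1
      · have hq2 : q.2 ≠ p.2 := fun h2 => hq (Prod.ext hq1 h2)
        simp [hq2]
      · simp [hq1]
  rw [hp]
  simp [h]

theorem controlledSwap_apply (f : Space ι n) (p : Fin (n + 1) × (Fin (n + 1) → ι)) :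
    controlledSwap ι n f p = f (swapIndex ι n p) := rfl

theorem controlledSwap_pureTensor_single (b : HilbertBasis ι ℂ H) (i : Fin (n + 1))
    (ψ : Fin (n + 1) → H) :
    controlledSwap ι n (pureTensor b (EuclideanSpace.single i 1) ψ)
      = pureTensor b (EuclideanSpace.single i 1) (ψ ∘ Equiv.swap 0 i) := by
  ext p
  rw [controlledSwap_apply, pureTensor_apply, pureTensor_apply]
  by_cases hp : p.1 = i
  · subst hp
    simp only [swapIndex, Equiv.coe_fn_mk, Function.comp]
    congr 1
    exact Fintype.prod_equiv (Equiv.swap 0 p.1) _ _ fun k => by simp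
  · simp [swapIndex, hp]

theorem norm_pureTensor (b : HilbertBasis ι ℂ H) (ν : EuclideanSpace ℂ (Fin (n + 1)))
    (ψ : Fin (n + 1) → H) : ‖pureTensor b ν ψ‖ = ‖ν‖ * ∏ k, ‖ψ k‖ := by
  have h := inner_pureTensor b ν ν ψ ψ
  simp only [inner_self_eq_norm_sq_to_K] at h
  have h' : ‖pureTensor b ν ψ‖ ^ 2 = (‖ν‖ * ∏ k, ‖ψ k‖) ^ 2 := by
    rw [mul_pow, ← Finset.prod_pow]
    exact_mod_cast h
  exact (pow_left_inj₀ (norm_nonneg _) (by positivity) two_ne_zero).1 h'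

/-- The map `h ↦ μ ⊗ h ⊗ χ ⊗ ⋯ ⊗ χ`. -/
noncomputable def attach (b : HilbertBasis ι ℂ H) (n : ℕ) (χ : H)
    (μ : EuclideanSpace ℂ (Fin (n + 1))) : H →L[ℂ] Space ι n :=
  LinearMap.mkContinuous
    ((pureTensorMultilinear b μ).toLinearMap (fun _ => χ) 0) (‖μ‖ * ‖χ‖ ^ n) (fun h => by
      change ‖pureTensor b μ (Function.update (fun _ => χ) 0 h)‖ ≤ _
      rw [norm_pureTensor, Fin.prod_univ_succ]
      simp only [Function.update_self, ne_eq, Fin.succ_ne_zero, not_false_eq_true,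
        Function.update_of_ne, Finset.prod_const, Finset.card_univ, Fintype.card_fin]
      apply le_of_eq; ring)

theorem attach_apply (b : HilbertBasis ι ℂ H) (χ : H) (μ : EuclideanSpace ℂ (Fin (n + 1)))
    (h : H) : attach b n χ μ h = pureTensor b μ (Fin.cons h fun _ => χ) := by
  change pureTensor b μ (Function.update (fun _ => χ) 0 h) = _
  congr 1
  ext k
  refine Fin.cases ?_ (fun k => ?_) k <;> simp

theorem quditProj_pureTensor (b : HilbertBasis ι ℂ H) {μ : EuclideanSpace ℂ (Fin (n + 1))}
    (hμ : ‖μ‖ = 1) (ν : EuclideanSpace ℂ (Fin (n + 1))) (ψ : Fin (n + 1) → H) :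
    quditProj b μ (pureTensor b ν ψ) = ⟪μ, ν⟫_ℂ • pureTensor b μ ψ := by
  rw [quditProj]
  refine Submodule.eq_starProjection_of_mem_orthogonal ?_ ?_
  · exact Submodule.smul_mem _ _ (Submodule.le_topologicalClosure _
      (Submodule.subset_span ⟨ψ, rfl⟩))
  · rw [Submodule.orthogonal_closure, Submodule.mem_orthogonal]
    refine fun u hu => (Submodule.mem_orthogonal_singleton_iff_inner_left.1 ?_)
    refine Submodule.span_le.2 ?_ hu
    rintro _ ⟨ψ', rfl⟩
    refine Submodule.mem_orthogonal_singleton_iff_inner_left.2 ?_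
    rw [inner_sub_right, inner_smul_right, inner_pureTensor, inner_pureTensor,
      inner_self_eq_norm_sq_to_K, hμ]
    simp

variable [CompleteSpace H]

theorem adjoint_attach_pureTensor (b : HilbertBasis ι ℂ H) (χ : H)
    (μ ν : EuclideanSpace ℂ (Fin (n + 1))) (ψ : Fin (n + 1) → H) :
    ContinuousLinearMap.adjoint (attach b n χ μ) (pureTensor b ν ψ)
      = (⟪μ, ν⟫_ℂ * ∏ k : Fin n, ⟪χ, ψ k.succ⟫_ℂ) • ψ 0 := by
  refine ext_inner_left ℂ fun h => ?_
  rw [ContinuousLinearMap.adjoint_inner_right, attach_apply, inner_pureTensor, inner_smul_right,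
    Fin.prod_univ_succ]
  simp only [Fin.cons_zero, Fin.cons_succ]
  ring

/-- The operator `A` with `A ρ A†` the output of the protocol on `ρ`: controlled swap followed by
contraction of the qudit with `μ` and of the last copies of `H` with `χ`. -/
noncomputable def contraction (b : HilbertBasis ι ℂ H) (n : ℕ) (χ : H)
    (μ : EuclideanSpace ℂ (Fin (n + 1))) : Space ι n →L[ℂ] H :=
  ContinuousLinearMap.adjoint (attach b n χ μ) ∘L controlledSwap ι n

theorem contraction_pureTensor_single (b : HilbertBasis ι ℂ H) (χ : H)
    (μ : EuclideanSpace ℂ (Fin (n + 1))) (i : Fin (n + 1)) (ψ : Fin (n + 1) → H) :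
    contraction b n χ μ (pureTensor b (EuclideanSpace.single i 1) ψ)
      = (star (μ i) * ∏ k ∈ Finset.univ.erase i, ⟪χ, ψ k⟫_ℂ) • ψ i := by
  have h : ∏ k : Fin n, ⟪χ, (ψ ∘ Equiv.swap 0 i) k.succ⟫_ℂ
      = ∏ k ∈ Finset.univ.erase i, ⟪χ, ψ k⟫_ℂ := by
    -- The transposition of `0` and `i` carries the nonzero slots bijectively onto the slots other
    -- than `i`.
    refine Finset.prod_bij (fun k _ => Equiv.swap 0 i k.succ) (fun k _ => ?_)
      (fun k _ l _ h => ?_) (fun k hk => ?_) (fun k _ => rfl)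
    · refine Finset.mem_erase.2 ⟨fun h => ?_, Finset.mem_univ _⟩
      rw [Equiv.swap_apply_eq_iff, Equiv.swap_apply_right] at h
      exact Fin.succ_ne_zero _ h
    · exact Fin.succ_injective _ ((Equiv.swap 0 i).injective h)
    · have h0 : Equiv.swap 0 i k ≠ 0 := by
        rw [Ne, Equiv.swap_apply_eq_iff, Equiv.swap_apply_left]
        exact Finset.ne_of_mem_erase hk
      obtain ⟨l, hl⟩ := Fin.exists_succ_eq.2 h0
      exact ⟨l, Finset.mem_univ _, by rw [hl, Equiv.swap_apply_self]⟩
  rw [contraction, ContinuousLinearMap.comp_apply, controlledSwap_pureTensor_single,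
    adjoint_attach_pureTensor, h]
  simp [EuclideanSpace.inner_single_right]

/-- On the range of the reference projection both sides are compared on generators `ν ⊗ h ⊗ χ ⊗ ⋯ ⊗
χ`. The complement does not matter: the range of `attach` lies in that subspace, so its adjoint
kills everything orthogonal to it. -/
theorem quditProj_comp_referenceProj (b : HilbertBasis ι ℂ H) {χ : H} (hχ : ‖χ‖ = 1)
    {μ : EuclideanSpace ℂ (Fin (n + 1))} (hμ : ‖μ‖ = 1) :
    quditProj b μ ∘L referenceProj b n χ
      = attach b n χ μ ∘L ContinuousLinearMap.adjoint (attach b n χ μ) := by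
  have key : ∀ w ∈ (Submodule.span ℂ {v | ∃ (ν : EuclideanSpace ℂ (Fin (n + 1))) (h : H),
      v = pureTensor b ν (Fin.cons h fun _ => χ)}).topologicalClosure,
      quditProj b μ w = attach b n χ μ (ContinuousLinearMap.adjoint (attach b n χ μ) w) := by
    intro w hw
    have hle := Submodule.topologicalClosure_minimal (t := (quditProj b μ
        - attach b n χ μ ∘L ContinuousLinearMap.adjoint (attach b n χ μ)).ker) _
      (Submodule.span_le.2 ?_) (ContinuousLinearMap.isClosed_ker _) hw
    · simpa [sub_eq_zero] using hle
    · rintro _ ⟨ν, h, rfl⟩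
      simp only [SetLike.mem_coe, LinearMap.mem_ker, ContinuousLinearMap.coe_coe,
        sub_apply, ContinuousLinearMap.comp_apply]
      rw [quditProj_pureTensor b hμ, adjoint_attach_pureTensor, map_smul, attach_apply]
      simp [hχ]
  ext1 v
  rw [ContinuousLinearMap.comp_apply, ContinuousLinearMap.comp_apply, key]
  · congr 1
    refine ext_inner_left ℂ fun h => ?_
    rw [ContinuousLinearMap.adjoint_inner_right, ContinuousLinearMap.adjoint_inner_right,
      ← sub_eq_zero, ← inner_sub_right, ← neg_eq_zero, ← inner_neg_right, neg_sub]
    refine Submodule.inner_right_of_mem_orthogonal (K := (Submodule.span ℂ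
      {v | ∃ (ν : EuclideanSpace ℂ (Fin (n + 1))) (h : H),
        v = pureTensor b ν (Fin.cons h fun _ => χ)}).topologicalClosure) ?_
      (Submodule.sub_starProjection_mem_orthogonal _)
    exact Submodule.le_topologicalClosure _ (Submodule.subset_span ⟨μ, h, attach_apply b χ μ h⟩)
  · exact Submodule.starProjection_apply_mem _ _

/-- The traced-out factors contribute `∑ |μ_i|²` and one Parseval sum for `‖χ‖²` per remaining copy
of `H`, all equal to 1. -/
theorem isPartialTrace_attach (b : HilbertBasis ι ℂ H) {χ : H} (hχ : ‖χ‖ = 1)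
    {μ : EuclideanSpace ℂ (Fin (n + 1))} (hμ : ‖μ‖ = 1) (S : H →L[ℂ] H) :
    IsPartialTrace b (attach b n χ μ ∘L S ∘L ContinuousLinearMap.adjoint (attach b n χ μ)) S := by
  intro x y
  have h1 : HasSum (fun i => μ i * star (μ i)) (1 : ℂ) := by
    have := hasSum_fintype (fun i => μ i * star (μ i))
    convert this
    have h := inner_self_eq_norm_sq_to_K (𝕜 := ℂ) μ
    rw [hμ, PiLp.inner_apply] at h
    simpa [-inner_self_eq_norm_sq_to_K, RCLike.inner_apply] using h.symm
  have h2 : HasSum (fun j => ⟪b j, χ⟫_ℂ * ⟪χ, b j⟫_ℂ) 1 := by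
    have := b.hasSum_inner_mul_inner χ χ
    rw [inner_self_eq_norm_sq_to_K, hχ] at this
    simpa [mul_comm] using this
  have h4 := (hasSum_mul_prod h1 (hasSum_prod_pi n (fun _ j => ⟪b j, χ⟫_ℂ * ⟪χ, b j⟫_ℂ) (fun _ => 1)
    fun _ => h2)).mul_right ⟪x, S y⟫_ℂ
  simp only [Finset.prod_const_one, one_mul] at h4
  refine hasSum_of_eq h4 fun p => ?_
  rw [ContinuousLinearMap.comp_apply, ← ContinuousLinearMap.adjoint_inner_left,
    ContinuousLinearMap.comp_apply, adjoint_attach_pureTensor, adjoint_attach_pureTensor]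
  simp only [Fin.cons_zero, Fin.cons_succ, map_smul, inner_smul_left, inner_smul_right, map_mul,
    map_prod, inner_conj_symm, Finset.prod_mul_distrib]
  simp [EuclideanSpace.inner_single_right, EuclideanSpace.inner_single_left]
  ring

end TensorCalculus

/-! ### The protocol as conjugation by the contraction. -/

section Protocol

variable {H : Type*} [NormedAddCommGroup H] [InnerProductSpace ℂ H] {ι : Type*} {n : ℕ}

theorem exists_muVec_apply {c : Fin (n + 1) → ℝ} (hc : ∀ i, 0 < c i) :
    ∃ N : ℝ, 0 < N ∧ ‖muVec c‖ = 1 ∧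
      ∀ i, muVec c i = ((N * (∏ k ∈ Finset.univ.erase i, √(c k))⁻¹ : ℝ) : ℂ) := by
  have hu : 0 < ‖(WithLp.toLp 2 fun i =>
      (((∏ k ∈ Finset.univ.erase i, √(c k))⁻¹ : ℝ) : ℂ) : EuclideanSpace ℂ (Fin (n + 1)))‖ := by
    rw [norm_pos_iff]
    intro h
    have h0 := congrArg (fun v : EuclideanSpace ℂ (Fin (n + 1)) => v 0) h
    have hpos : 0 < ∏ k ∈ Finset.univ.erase (0 : Fin (n + 1)), √(c k) :=
      Finset.prod_pos fun k _ => Real.sqrt_pos.2 (hc k)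
    have h1 : ((∏ k ∈ Finset.univ.erase (0 : Fin (n + 1)), √(c k))⁻¹ : ℝ) = 0 := by
      exact Complex.ofReal_eq_zero.1 h0
    exact (inv_ne_zero hpos.ne') h1
  refine ⟨_, inv_pos.2 hu, ?_, fun i => ?_⟩
  · rw [muVec, norm_smul, Complex.norm_real, norm_inv, norm_norm]
    exact inv_mul_cancel₀ hu.ne'
  · rw [muVec, PiLp.smul_apply, smul_eq_mul, Complex.ofReal_mul]

theorem superposition_eq {χ : H} {c : Fin (n + 1) → ℝ} {α : EuclideanSpace ℂ (Fin (n + 1))}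
    {ψ : Fin (n + 1) → H} (h : IsInput χ c α ψ) :
    superposition χ α ψ = ∑ i, (α i * ((∏ k ∈ Finset.univ.erase i, ⟪χ, ψ k⟫_ℂ) /
      ((∏ k ∈ Finset.univ.erase i, √(c k) : ℝ) : ℂ))) • ψ i := by
  have : ∀ k, ‖⟪χ, ψ k⟫_ℂ‖ = √(c k) := fun k => by
    rw [← (h.2 k).2, Real.sqrt_sq (norm_nonneg _)]
  simp only [superposition, this]

variable [CompleteSpace H]

/-- On admissible inputs the denominators of the superposition depend on `c` alone, and up to the
normalization `N` their inverses are the coordinates of `muVec c`. This is why a linear operator can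
produce the superposition. -/
theorem contraction_pureTensor_of_isInput (b : HilbertBasis ι ℂ H) {χ : H} {c : Fin (n + 1) → ℝ}
    {N : ℝ} (hN : ∀ i, muVec c i = ((N * (∏ k ∈ Finset.univ.erase i, √(c k))⁻¹ : ℝ) : ℂ))
    {α : EuclideanSpace ℂ (Fin (n + 1))} {ψ : Fin (n + 1) → H} (h : IsInput χ c α ψ) :
    contraction b n χ (muVec c) (pureTensor b α ψ) = (N : ℂ) • superposition χ α ψ := by
  rw [superposition_eq h, pureTensor_eq_sum, map_sum, Finset.smul_sum]
  refine Finset.sum_congr rfl fun i _ => ?_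
  rw [map_smul, contraction_pureTensor_single, hN, smul_smul, smul_smul]
  congr 1
  simp only [RCLike.star_def, Complex.conj_ofReal]
  push_cast
  ring

theorem isPartialTrace_contraction (b : HilbertBasis ι ℂ H) {χ : H} (hχ : ‖χ‖ = 1)
    {μ : EuclideanSpace ℂ (Fin (n + 1))} (hμ : ‖μ‖ = 1) (T : Space ι n →L[ℂ] Space ι n) :
    IsPartialTrace b
      ((quditProj b μ ∘L referenceProj b n χ ∘L controlledSwap ι n) ∘L T ∘L
        ContinuousLinearMap.adjoint
          (quditProj b μ ∘L referenceProj b n χ ∘L controlledSwap ι n))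
      (contraction b n χ μ ∘L T ∘L ContinuousLinearMap.adjoint (contraction b n χ μ)) := by
  have hV : quditProj b μ ∘L referenceProj b n χ ∘L controlledSwap ι n
      = attach b n χ μ ∘L contraction b n χ μ := by
    rw [← ContinuousLinearMap.comp_assoc, quditProj_comp_referenceProj b hχ hμ, contraction,
      ContinuousLinearMap.comp_assoc]
  have h := isPartialTrace_attach b hχ hμ
    (contraction b n χ μ ∘L T ∘L ContinuousLinearMap.adjoint (contraction b n χ μ))
  rw [hV, ContinuousLinearMap.adjoint_comp]
  simp only [ContinuousLinearMap.comp_assoc] at h ⊢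
  exact h

end Protocol

/-! ### Rank-one decompositions and conjugation of trace-class operators. -/

section TraceClassCalculus

variable {X : Type*} [NormedAddCommGroup X] [InnerProductSpace ℂ X]
variable {K : Type*} [NormedAddCommGroup K] [InnerProductSpace ℂ K]

theorem rankOne_mem_traceClass (x y : X) : InnerProductSpace.rankOne ℂ x y ∈ TraceClass X := by
  refine ⟨Pi.single 0 x, Pi.single 0 y, ?_, ?_⟩
  · refine summable_of_ne_finset_zero (s := {0}) fun k hk => ?_
    have hk0 : k ≠ 0 := by simpa using hk
    simp [Pi.single_eq_of_ne hk0]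
  · have h := hasSum_single (f := fun k => InnerProductSpace.rankOne ℂ
      ((Pi.single 0 x : ℕ → X) k) ((Pi.single 0 y : ℕ → X) k)) 0
      (fun k hk => by simp [Pi.single_eq_of_ne hk])
    simpa using h

/-- The operator `|x⟩⟨y|`, as a linear function of `x`. -/
noncomputable def outer (y : X) : X →ₗ[ℂ] TraceClass X where
  toFun x := ⟨InnerProductSpace.rankOne ℂ x y, rankOne_mem_traceClass x y⟩
  map_add' x x' := by ext; simp
  map_smul' a x := by ext; simp

theorem coe_outer (x y : X) : (outer y x : X →L[ℂ] X) = InnerProductSpace.rankOne ℂ x y := rfl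

theorem ketbra_eq_outer (x : X) : ketbra x = outer x x := rfl

/-- The trace-class operator `∑ₖ |xₖ⟩⟨yₖ|` converges in operator norm. -/
theorem summable_rankOne [CompleteSpace X] {A : Type*} {x y : A → X}
    (h : Summable fun k => ‖x k‖ * ‖y k‖) :
    Summable fun k => InnerProductSpace.rankOne ℂ (x k) (y k) := by
  refine Summable.of_norm ?_
  simpa using h

/-- An operator of the form `∑ₖ |zₖ⟩⟨zₖ|` with `∑ₖ ‖zₖ‖² < ∞`. -/
def IsKetbraSum (z : ℕ → X) (T : TraceClass X) : Prop :=
  Summable (fun k => ‖z k‖ ^ 2) ∧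
    HasSum (fun k => InnerProductSpace.rankOne ℂ (z k) (z k)) (T : X →L[ℂ] X)

theorem exists_isKetbraSum [CompleteSpace X] {z : ℕ → X} (hz : Summable fun k => ‖z k‖ ^ 2) :
    ∃ T, IsKetbraSum z T := by
  have h : Summable fun k => ‖z k‖ * ‖z k‖ := by simpa [sq] using hz
  exact ⟨⟨_, z, z, h, (summable_rankOne h).hasSum⟩, hz, (summable_rankOne h).hasSum⟩

/-- Every trace-class operator is a linear combination of four sums `∑ₖ |zₖ⟩⟨zₖ|`. -/
theorem eq_top_of_isKetbraSum_mem [CompleteSpace X] {P : Submodule ℂ (TraceClass X)}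
    (hP : ∀ z T, IsKetbraSum z T → T ∈ P) : P = ⊤ := by
  refine eq_top_iff.2 fun T _ => ?_
  obtain ⟨x, y, hxy, hT⟩ := T.2
  -- Rescaling `x` and `y` inversely gives them equal norms, which makes both sequences
  -- square-summable without changing `|x⟩⟨y|`.
  have hbal : ∀ k, ∃ x' y' : X, ‖x'‖ ^ 2 = ‖x k‖ * ‖y k‖ ∧ ‖y'‖ ^ 2 = ‖x k‖ * ‖y k‖ ∧
      InnerProductSpace.rankOne ℂ x' y' = InnerProductSpace.rankOne ℂ (x k) (y k) := by
    intro k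
    by_cases hx : x k = 0
    · exact ⟨0, 0, by simp [hx], by simp [hx], by simp [hx]⟩
    by_cases hy : y k = 0
    · exact ⟨0, 0, by simp [hy], by simp [hy], by simp [hy]⟩
    have hx' := norm_pos_iff.2 hx
    have hy' := norm_pos_iff.2 hy
    have h1 : √(‖y k‖ / ‖x k‖) ^ 2 = ‖y k‖ / ‖x k‖ := Real.sq_sqrt (by positivity)
    have h0 : 0 < √(‖y k‖ / ‖x k‖) := Real.sqrt_pos.2 (by positivity)
    refine ⟨((√(‖y k‖ / ‖x k‖) : ℝ) : ℂ) • x k, (((√(‖y k‖ / ‖x k‖))⁻¹ : ℝ) : ℂ) • y k, ?_, ?_, ?_⟩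
    · rw [norm_smul, mul_pow, Complex.norm_real, Real.norm_eq_abs, sq_abs, h1]
      field_simp
    · rw [norm_smul, mul_pow, Complex.norm_real, Real.norm_eq_abs, sq_abs, inv_pow, h1]
      field_simp
    · ext v
      simp only [InnerProductSpace.rankOne_apply, inner_smul_left, smul_smul, Complex.conj_ofReal]
      congr 1
      rw [mul_right_comm, ← Complex.ofReal_mul, inv_mul_cancel₀ h0.ne']
      simp
  choose x' y' hx' hy' hr using hbal
  have hsum : ∀ a : ℂ, Summable fun k => ‖x' k + a • y' k‖ ^ 2 := by
    intro a
    refine Summable.of_nonneg_of_le (fun _ => by positivity) (fun k => ?_)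
      (hxy.mul_left (2 + 2 * ‖a‖ ^ 2))
    have h1 : ‖x' k + a • y' k‖ ≤ ‖x' k‖ + ‖a‖ * ‖y' k‖ := by
      rw [← norm_smul]; exact norm_add_le _ _
    calc ‖x' k + a • y' k‖ ^ 2 ≤ (‖x' k‖ + ‖a‖ * ‖y' k‖) ^ 2 := by gcongr
      _ ≤ 2 * ‖x' k‖ ^ 2 + 2 * (‖a‖ ^ 2 * ‖y' k‖ ^ 2) := by
        nlinarith [sq_nonneg (‖x' k‖ - ‖a‖ * ‖y' k‖)]
      _ = (2 + 2 * ‖a‖ ^ 2) * (‖x k‖ * ‖y k‖) := by rw [hx', hy']; ring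
  choose S hS using fun a => exists_isKetbraSum (hsum a)
  -- Polarization: `4 |x⟩⟨y| = ∑ a |x + a y⟩⟨x + a y|` over the fourth roots of unity `a`.
  have hT4 : T = (4 : ℂ)⁻¹ • (S 1 - S (-1) + Complex.I • S Complex.I
      - Complex.I • S (-Complex.I)) := by
    ext1
    refine hT.unique ?_
    have h := ((((hS 1).2.sub (hS (-1)).2).add ((hS Complex.I).2.const_smul Complex.I)).sub
      ((hS (-Complex.I)).2.const_smul Complex.I)).const_smul (4 : ℂ)⁻¹
    refine hasSum_of_eq h fun k => ?_
    rw [← hr k]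
    ext v
    simp only [InnerProductSpace.rankOne_apply, smul_apply, add_apply, sub_apply,
      inner_add_left, inner_smul_left, smul_add, add_smul, smul_smul]
    simp only [map_one, map_neg, Complex.conj_I, neg_smul, neg_mul, one_mul, neg_neg]
    match_scalars <;> ring_nf <;> (try rw [Complex.I_sq]) <;> ring
  rw [hT4]
  exact P.smul_mem _ (P.sub_mem (P.add_mem (P.sub_mem (hP _ _ (hS _)) (hP _ _ (hS _)))
    (P.smul_mem _ (hP _ _ (hS _)))) (P.smul_mem _ (hP _ _ (hS _))))

variable [CompleteSpace X] [CompleteSpace K]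

/-- The map `T ↦ A T A†` on trace-class operators. -/
noncomputable def conjugation (A : X →L[ℂ] K) : TraceClass X →ₗ[ℂ] TraceClass K where
  toFun T := ⟨A ∘L (T : X →L[ℂ] X) ∘L ContinuousLinearMap.adjoint A, by
    obtain ⟨x, y, h, hT⟩ := T.2
    refine ⟨fun k => A (x k), fun k => A (y k), ?_, ?_⟩
    · refine Summable.of_nonneg_of_le (fun _ => by positivity) (fun k => ?_)
        (h.mul_left (‖A‖ * ‖A‖))
      calc ‖A (x k)‖ * ‖A (y k)‖ ≤ (‖A‖ * ‖x k‖) * (‖A‖ * ‖y k‖) := by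
            gcongr <;> exact A.le_opNorm _
        _ = _ := by ring
    · have h1 := (hT.mapL ((ContinuousLinearMap.compL ℂ K X X).flip
        (ContinuousLinearMap.adjoint A))).mapL (ContinuousLinearMap.compL ℂ K X K A)
      refine hasSum_of_eq h1 fun k => ?_
      ext v
      simp [ContinuousLinearMap.adjoint_inner_right]⟩
  map_add' S T := by ext; simp
  map_smul' a T := by ext; simp

theorem coe_conjugation (A : X →L[ℂ] K) (T : TraceClass X) :
    (conjugation A T : K →L[ℂ] K) = A ∘L (T : X →L[ℂ] X) ∘L ContinuousLinearMap.adjoint A := rfl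

theorem isCP_conjugation (A : X →L[ℂ] K) : IsCP (conjugation A) := by
  intro m T hT x
  have h := hT fun i => ContinuousLinearMap.adjoint A (x i)
  simpa [coe_conjugation, ContinuousLinearMap.adjoint_inner_left] using h

theorem conjugation_outer (A : X →L[ℂ] K) (x y : X) :
    conjugation A (outer y x) = outer (A y) (A x) := by
  ext v
  simp [coe_conjugation, coe_outer, ContinuousLinearMap.adjoint_inner_right]

end TraceClassCalculus

/-! ### Multilinear maps that produce superpositions on latitudes around `χ`. -/

section Multilinear

variable {H : Type*} [NormedAddCommGroup H] [InnerProductSpace ℂ H]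
variable {κ : Type*} [dκ : DecidableEq κ]

theorem inner_update (χ : H) (ψ : κ → H) (j : κ) (x : H) (k : κ) :
    ⟪χ, Function.update ψ j x k⟫_ℂ = Function.update (fun k => ⟪χ, ψ k⟫_ℂ) j ⟪χ, x⟫_ℂ k :=
  Function.apply_update (fun _ v => ⟪χ, v⟫_ℂ) ψ j x k

theorem update_mem_pi {Y : Type*} {S : κ → Set Y} {ψ : κ → Y} (hψ : ∀ k, ψ k ∈ S k) {j : κ}
    {v : Y} (hv : v ∈ S j) (k : κ) : Function.update ψ j v k ∈ S k := by
  by_cases h : k = j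
  · subst h; simpa using hv
  · rw [Function.update_of_ne h]; exact hψ k

variable [Fintype κ]

/-- The vectors `χ + ξ` with `ξ` orthogonal to `χ` of norm `t`. -/
def latitude (χ : H) (t : ℝ) : Set H := {v | ⟪χ, v - χ⟫_ℂ = 0 ∧ ‖v - χ‖ = t}

theorem mem_latitude_rotate {χ v : H} {t : ℝ} (hv : v ∈ latitude χ t) {a : ℂ} (ha : ‖a‖ = 1) :
    χ + a • (v - χ) ∈ latitude χ t := by
  refine ⟨?_, ?_⟩
  · rw [add_sub_cancel_left, inner_smul_right, hv.1, mul_zero]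
  · rw [add_sub_cancel_left, norm_smul, ha, one_mul, hv.2]

theorem inner_of_mem_latitude {χ v : H} (hχ : ‖χ‖ = 1) {t : ℝ} (hv : v ∈ latitude χ t) :
    ⟪χ, v⟫_ℂ = 1 := by
  have h := hv.1
  rw [inner_sub_right, inner_self_eq_norm_sq_to_K, hχ] at h
  simpa [sub_eq_zero] using h

theorem latitude_nonempty {χ ξ : H} (hξ : ξ ≠ 0) (hχξ : ⟪χ, ξ⟫_ℂ = 0) {t : ℝ} (ht : 0 < t) :
    χ + ((t / ‖ξ‖ : ℝ) : ℂ) • ξ ∈ latitude χ t := by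
  have := norm_pos_iff.2 hξ
  refine ⟨?_, ?_⟩
  · rw [add_sub_cancel_left, inner_smul_right, hχξ, mul_zero]
  · rw [add_sub_cancel_left, norm_smul, Complex.norm_real, Real.norm_of_nonneg (by positivity)]
    field_simp

/-- `χ` is the midpoint of the opposite points `χ ± ξ`; subtracting it leaves every direction
orthogonal to `χ`. Multilinear maps are thus determined by their values on latitudes. -/
theorem span_latitude {χ ξ : H} (hχ : ‖χ‖ = 1) (hξ : ξ ≠ 0) (hχξ : ⟪χ, ξ⟫_ℂ = 0) {t : ℝ}
    (ht : 0 < t) : Submodule.span ℂ (latitude χ t) = ⊤ := by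
  have h2 : ∀ v ∈ latitude χ t, (2 : ℂ) • χ ∈ Submodule.span ℂ (latitude χ t) := by
    intro v hv
    have := Submodule.add_mem (Submodule.span ℂ (latitude χ t)) (Submodule.subset_span hv)
      (Submodule.subset_span (mem_latitude_rotate hv (a := -1) (by simp)))
    convert this using 1
    module
  have hχmem : χ ∈ Submodule.span ℂ (latitude χ t) := by
    have := Submodule.smul_mem _ (2 : ℂ)⁻¹ (h2 _ (latitude_nonempty hξ hχξ ht))
    rwa [smul_smul, inv_mul_cancel₀ two_ne_zero, one_smul] at this
  have horth : ∀ w : H, ⟪χ, w⟫_ℂ = 0 → w ∈ Submodule.span ℂ (latitude χ t) := by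
    intro w hw
    by_cases hw0 : w = 0
    · rw [hw0]; exact Submodule.zero_mem _
    have hn := norm_pos_iff.2 hw0
    have h3 := Submodule.sub_mem (Submodule.span ℂ (latitude χ t))
      (Submodule.subset_span (latitude_nonempty hw0 hw ht)) hχmem
    rw [add_sub_cancel_left] at h3
    have h4 : ((t / ‖w‖ : ℝ) : ℂ) ≠ 0 := by
      exact_mod_cast (by positivity : t / ‖w‖ ≠ 0)
    exact (Submodule.smul_mem_iff _ h4).1 h3
  refine eq_top_iff.2 fun v _ => ?_
  have hv : v = ⟪χ, v⟫_ℂ • χ + (v - ⟪χ, v⟫_ℂ • χ) := by abel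
  rw [hv]
  refine Submodule.add_mem _ (Submodule.smul_mem _ _ hχmem) (horth _ ?_)
  rw [inner_sub_right, inner_smul_right, inner_self_eq_norm_sq_to_K, hχ]
  simp

/-- A linear map for which all the vectors `χ + ξ` on a latitude are eigenvectors has the same
eigenvalue on all of them. -/
theorem eigenvalue_eq_of_latitude {χ : H} (hχ : ‖χ‖ = 1) {t : ℝ} (L : H →ₗ[ℂ] H)
    {lam : H → ℂ} (hL : ∀ v ∈ latitude χ t, L v = lam v • v) {v v' : H}
    (hv : v ∈ latitude χ t) (hv' : v' ∈ latitude χ t) : lam v = lam v' := by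
  -- The common eigenvalue has to be `⟨χ|L χ⟩`. This holds once `⟨χ|L ξ⟩` is shown to contribute
  -- nothing.
  have key : ∀ v ∈ latitude χ t, ⟪χ, L χ⟫_ℂ = lam v := by
    intro v hv
    obtain ⟨ξ, hξ⟩ : ∃ ξ, ξ = v - χ := ⟨_, rfl⟩
    have hrot : ∀ a : ℂ, ‖a‖ = 1 → L χ + a • L ξ = lam (χ + a • ξ) • (χ + a • ξ) := by
      intro a ha
      rw [← map_smul, ← map_add]
      exact hL _ (hξ ▸ mem_latitude_rotate hv ha)
    have horth : ⟪χ, ξ⟫_ℂ = 0 := hξ ▸ hv.1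
    have hχχ : ⟪χ, χ⟫_ℂ = 1 := by rw [inner_self_eq_norm_sq_to_K, hχ]; simp
    have hsc : ∀ a : ℂ, ‖a‖ = 1 → ⟪χ, L χ⟫_ℂ + a * ⟪χ, L ξ⟫_ℂ = lam (χ + a • ξ) := by
      intro a ha
      have := congrArg (fun w => ⟪χ, w⟫_ℂ) (hrot a ha)
      simpa only [inner_add_right, inner_smul_right, horth, hχχ, mul_zero, add_zero,
        mul_one] using this
    have hvec : ∀ a : ℂ, ‖a‖ = 1 → L χ + a • L ξ
        = (⟪χ, L χ⟫_ℂ + a * ⟪χ, L ξ⟫_ℂ) • (χ + a • ξ) := by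
      intro a ha
      rw [hsc a ha, hrot a ha]
    have h1 := hvec 1 (by simp)
    have h2 := hvec (-1) (by simp)
    have h3 := hvec Complex.I (by simp)
    have h4 := hvec (-Complex.I) (by simp)
    -- In `hvec` the left side has degree one in `a` and the right side degree two. The signs `+, +,
    -- -, -` at `a = 1, -1, i, -i` isolate the coefficient of `a²`.
    have h5 : (4 * ⟪χ, L ξ⟫_ℂ) • ξ = 0 := by
      have : (L χ + (1 : ℂ) • L ξ) + (L χ + (-1 : ℂ) • L ξ)
          - (L χ + Complex.I • L ξ) - (L χ + (-Complex.I) • L ξ) = 0 := by module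
      rw [h1, h2, h3, h4] at this
      rw [← this]
      match_scalars
      · linear_combination (2 * ⟪χ, L ξ⟫_ℂ) * Complex.I_sq
      · ring
    have h6 : ⟪χ, L ξ⟫_ℂ = 0 ∨ ξ = 0 := by simpa using h5
    have h7 : ⟪χ, L ξ⟫_ℂ = 0 := by
      rcases h6 with h | h
      · exact h
      · rw [h]; simp
    have h8 := hsc 1 (by simp)
    rw [h7, mul_zero, add_zero, one_smul, hξ, add_sub_cancel] at h8
    exact h8
  rw [← key v hv, ← key v' hv']

/-- A latitude contains a vector different from two given ones, at every positive radius. -/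
theorem exists_mem_latitude_ne {χ ξ : H} (hξ : ξ ≠ 0) (hχξ : ⟪χ, ξ⟫_ℂ = 0) {t : ℝ} (ht : 0 < t)
    (v v' : H) : ∃ u ∈ latitude χ t, u ≠ v ∧ u ≠ v' := by
  have h0 := latitude_nonempty hξ hχξ ht
  obtain ⟨w, hw⟩ : ∃ w, w = χ + ((t / ‖ξ‖ : ℝ) : ℂ) • ξ := ⟨_, rfl⟩
  rw [← hw] at h0
  have hne : w - χ ≠ 0 := by
    intro h
    have := h0.2
    rw [h, norm_zero] at this
    exact ht.ne this
  have hinj : ∀ a a' : ℂ, a ≠ a' → χ + a • (w - χ) ≠ χ + a' • (w - χ) := by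
    intro a a' haa h
    exact haa (smul_left_injective ℂ hne (add_left_cancel h))
  -- Three distinct points of the latitude cannot all lie in `{v, v'}`.
  have m1 := mem_latitude_rotate h0 (a := 1) (by simp)
  have m2 := mem_latitude_rotate h0 (a := -1) (by simp)
  have m3 := mem_latitude_rotate h0 (a := Complex.I) (by simp)
  have n12 := hinj 1 (-1) (by norm_num)
  have n13 := hinj 1 Complex.I (by simp [Complex.ext_iff])
  have n23 := hinj (-1) Complex.I (by simp [Complex.ext_iff])
  by_contra! hcon
  have c1 := hcon _ m1
  have c2 := hcon _ m2
  have c3 := hcon _ m3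
  grind

/-- A function on a product of sets that does not change when a single coordinate changes is
constant. -/
theorem eq_of_forall_update {Y B : Type*} {S : κ → Set Y} {f : (κ → Y) → B}
    (h : ∀ ψ : κ → Y, (∀ k, ψ k ∈ S k) → ∀ j, ∀ v ∈ S j, f (Function.update ψ j v) = f ψ)
    {ψ φ : κ → Y} (hψ : ∀ k, ψ k ∈ S k) (hφ : ∀ k, φ k ∈ S k) : f ψ = f φ := by
  have key : ∀ s : Finset κ, f (s.piecewise φ ψ) = f ψ := by
    intro s
    induction s using Finset.induction_on with
    | empty => simp
    | insert j s hj ih =>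
      rw [Finset.piecewise_insert, h _ _ _ _ (hφ j), ih]
      intro k
      by_cases hk : k ∈ s
      · rw [Finset.piecewise_eq_of_mem _ _ _ hk]; exact hφ k
      · rw [Finset.piecewise_eq_of_notMem _ _ _ hk]; exact hψ k
  rw [← key Finset.univ, Finset.piecewise_univ]

/-- The multilinear map `ψ ↦ (∏_{k ≠ i} ⟨χ|ψ_k⟩) ψ_i`. -/
noncomputable def overlapMultilinear (χ : H) (i : κ) : MultilinearMap ℂ (fun _ : κ => H) H where
  toFun ψ := (∏ k ∈ Finset.univ.erase i, ⟪χ, ψ k⟫_ℂ) • ψ i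
  map_update_add' := by
    intro inst ψ j x y
    obtain rfl : inst = dκ := Subsingleton.elim _ _
    simp only [inner_update χ]
    by_cases hj : j = i
    · subst hj
      simp [Finset.prod_update_of_notMem]
    · have hmem : j ∈ Finset.univ.erase i := Finset.mem_erase.2 ⟨hj, Finset.mem_univ _⟩
      simp only [Finset.prod_update_of_mem hmem, Function.update_of_ne (Ne.symm hj),
        inner_add_right]
      module
  map_update_smul' := by
    intro inst ψ j a x
    obtain rfl : inst = dκ := Subsingleton.elim _ _
    simp only [inner_update χ]
    by_cases hj : j = i
    · subst hj
      simp [Finset.prod_update_of_notMem, smul_smul, mul_comm]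
    · have hmem : j ∈ Finset.univ.erase i := Finset.mem_erase.2 ⟨hj, Finset.mem_univ _⟩
      simp only [Finset.prod_update_of_mem hmem, Function.update_of_ne (Ne.symm hj),
        inner_smul_right]
      module

theorem overlapMultilinear_apply (χ : H) (i : κ) (ψ : κ → H) :
    overlapMultilinear χ i ψ = (∏ k ∈ Finset.univ.erase i, ⟪χ, ψ k⟫_ℂ) • ψ i := rfl

/-- Multilinear maps `N i` for which every combination `∑ β i • N i ψ` is proportional to
`∑ β i • ψ i` for all `ψ` on given latitudes around `χ`. -/
theorem multilinear_superposition {χ ξ : H} (hχ : ‖χ‖ = 1) (hξ : ξ ≠ 0) (hχξ : ⟪χ, ξ⟫_ℂ = 0)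
    {t : κ → ℝ} (ht : ∀ k, 0 < t k) (N : κ → MultilinearMap ℂ (fun _ : κ => H) H)
    (hN : ∀ ψ : κ → H, (∀ k, ψ k ∈ latitude χ (t k)) → ∀ β : κ → ℂ,
      ∃ s : ℂ, ∑ i, β i • N i ψ = s • ∑ i, β i • ψ i) :
    ∃ m : ℂ, ∀ i ψ, N i ψ = (m * ∏ k ∈ Finset.univ.erase i, ⟪χ, ψ k⟫_ℂ) • ψ i := by
  -- Taking `β` to be the `i`-th basis vector makes `ψ i` an eigenvector in slot `i`. It remains to
  -- show that the eigenvalue depends on neither `i` nor `ψ`.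
  obtain ⟨lam, hlam⟩ : ∃ lam : κ → (κ → H) → ℂ, ∀ i ψ, (∀ k, ψ k ∈ latitude χ (t k)) →
      N i ψ = lam i ψ • ψ i := by
    have h : ∀ i ψ, ∃ s : ℂ, (∀ k, ψ k ∈ latitude χ (t k)) → N i ψ = s • ψ i := by
      intro i ψ
      by_cases hψ : ∀ k, ψ k ∈ latitude χ (t k)
      · obtain ⟨s, hs⟩ := hN ψ hψ (Pi.single i 1)
        exact ⟨s, fun _ => by simpa [Pi.single_apply, ite_smul] using hs⟩
      · exact ⟨0, fun h => absurd h hψ⟩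
    choose lam hlam using h
    exact ⟨lam, hlam⟩
  have hself : ∀ i ψ, (∀ k, ψ k ∈ latitude χ (t k)) → ∀ v ∈ latitude χ (t i),
      lam i (Function.update ψ i v) = lam i ψ := by
    intro i ψ hψ v hv
    have := eigenvalue_eq_of_latitude hχ ((N i).toLinearMap ψ i)
      (lam := fun w => lam i (Function.update ψ i w)) (t := t i) (fun w hw => by
        have := hlam i (Function.update ψ i w) (update_mem_pi hψ hw)
        rw [Function.update_self] at this
        exact this) hv (hψ i)
    simpa using this
  -- With `β = e_i + e_j`, pairing with `χ` gives `lam i ψ + lam j ψ = 2 s`; what remains is `(lam i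
  -- ψ - s) • (ψ i - ψ j) = 0`.
  have hpair : ∀ i j ψ, (∀ k, ψ k ∈ latitude χ (t k)) → ψ i ≠ ψ j → lam i ψ = lam j ψ := by
    intro i j ψ hψ hij
    have hij' : i ≠ j := fun h => hij (h ▸ rfl)
    obtain ⟨s, hs⟩ := hN ψ hψ (Pi.single i 1 + Pi.single j 1)
    simp only [Pi.add_apply, add_smul, Finset.sum_add_distrib, Pi.single_apply, ite_smul,
      one_smul, zero_smul, Finset.sum_ite_eq', Finset.mem_univ, if_true] at hs
    rw [hlam i ψ hψ, hlam j ψ hψ] at hs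
    have h1 := congrArg (fun w => ⟪χ, w⟫_ℂ) hs
    simp only [inner_add_right, inner_smul_right, inner_of_mem_latitude hχ (hψ _), mul_one] at h1
    have h2 : (lam i ψ - s) • (ψ i - ψ j) = 0 := by
      have h3 : lam j ψ = 2 * s - lam i ψ := by linear_combination h1
      rw [h3] at hs
      rw [← sub_eq_zero] at hs
      rw [← hs]
      module
    rcases smul_eq_zero.1 h2 with h | h
    · linear_combination 2 * h - h1
    · exact absurd (sub_eq_zero.1 h) hij
  have hupd : ∀ i ψ, (∀ k, ψ k ∈ latitude χ (t k)) → ∀ j, ∀ v ∈ latitude χ (t j),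
      lam i (Function.update ψ j v) = lam i ψ := by
    intro i ψ hψ j v hv
    by_cases hij : j = i
    · subst hij; exact hself j ψ hψ v hv
    -- Putting in slot `i` a vector different from both `ψ j` and `v` turns the eigenvalue for `i`
    -- into the one for `j`, before and after the change. By `hself` the latter ignores slot `j`.
    obtain ⟨u, hu, hu1, hu2⟩ := exists_mem_latitude_ne hξ hχξ (ht i) (ψ j) v
    have hψu := update_mem_pi hψ hu
    have hψv := update_mem_pi hψ hv
    have hψuv := update_mem_pi hψu hv
    rw [← hself i _ hψv u hu, ← hself i ψ hψ u hu, Function.update_comm hij,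
      hpair i j _ hψuv (by simpa [Ne.symm hij] using hu2), hself j _ hψu v hv,
      hpair i j _ hψu (by simpa [hij] using hu1)]
  have hex : ∀ k, (latitude χ (t k)).Nonempty := fun k => ⟨_, latitude_nonempty hξ hχξ (ht k)⟩
  choose φ hφ using hex
  have hconst : ∀ i ψ, (∀ k, ψ k ∈ latitude χ (t k)) → lam i ψ = lam i φ := fun i ψ hψ =>
    eq_of_forall_update (hupd i) hψ hφ
  have hall : ∀ i j, lam i φ = lam j φ := by
    intro i j
    by_cases hij : i = j
    · rw [hij]
    obtain ⟨u, hu, hu1, -⟩ := exists_mem_latitude_ne hξ hχξ (ht i) (φ j) (φ j)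
    have hφu := update_mem_pi hφ hu
    rw [← hconst i _ hφu, ← hconst j _ hφu]
    exact hpair i j _ hφu (by simpa [Ne.symm hij] using hu1)
  obtain ⟨m, hm⟩ : ∃ m, ∀ i, lam i φ = m := by
    by_cases h : Nonempty κ
    · obtain ⟨j⟩ := h
      exact ⟨lam j φ, fun i => hall i j⟩
    · exact ⟨0, fun i => absurd ⟨i⟩ h⟩
  refine ⟨m, fun i => ?_⟩
  have hG : N i = m • overlapMultilinear χ i := by
    -- On latitudes every overlap is 1, so both sides are `m • ψ i` there, and the spanning property
    -- does the rest.
    refine MultilinearMap.ext_of_span_eq_top (γ := fun k => latitude χ (t k))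
      (g := fun k v => (v : H)) (fun k => ?_) fun ψ => ?_
    · rw [Subtype.range_coe]; exact span_latitude hχ hξ hχξ (ht k)
    · have hψ : ∀ k, (ψ k : H) ∈ latitude χ (t k) := fun k => (ψ k).2
      rw [hlam i _ hψ, hconst i _ hψ, hm]
      rw [smul_apply, overlapMultilinear_apply]
      simp [inner_of_mem_latitude hχ (hψ _)]
  intro ψ
  rw [hG, smul_apply, overlapMultilinear_apply, smul_smul]

end Multilinear

/-! ### Automatic continuity of positive functionals; Cauchy–Schwarz for CP maps. -/

section Positivity

variable {X : Type*} [NormedAddCommGroup X] [InnerProductSpace ℂ X]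
variable {K : Type*} [NormedAddCommGroup K] [InnerProductSpace ℂ K]

/-- A linear functional on trace-class operators that is nonnegative on positive operators. -/
def IsPositiveFunctional (φ : TraceClass X →ₗ[ℂ] ℂ) : Prop :=
  ∀ T : TraceClass X, (∀ x, 0 ≤ ⟪x, (T : X →L[ℂ] X) x⟫_ℂ) → 0 ≤ φ T

theorem IsKetbraSum.hasSum_inner {z : ℕ → X} {T : TraceClass X} (h : IsKetbraSum z T) (x : X) :
    HasSum (fun k => ⟪x, z k⟫_ℂ * ⟪z k, x⟫_ℂ) ⟪x, (T : X →L[ℂ] X) x⟫_ℂ := by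
  have h1 := (h.2.mapL (ContinuousLinearMap.apply ℂ X x)).mapL (innerSL ℂ x)
  refine hasSum_of_eq h1 fun k => ?_
  simp [mul_comm]

theorem inner_mul_inner_nonneg (x y : X) : 0 ≤ ⟪x, y⟫_ℂ * ⟪y, x⟫_ℂ := by
  rw [← inner_conj_symm y x]
  exact mul_star_self_nonneg _

theorem IsKetbraSum.inner_nonneg {z : ℕ → X} {T : TraceClass X} (h : IsKetbraSum z T) (x : X) :
    0 ≤ ⟪x, (T : X →L[ℂ] X) x⟫_ℂ :=
  (h.hasSum_inner x).nonneg fun _ => inner_mul_inner_nonneg _ _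

theorem IsKetbraSum.smul {z : ℕ → X} {T : TraceClass X} (h : IsKetbraSum z T) (a : ℝ) :
    IsKetbraSum (fun k => (a : ℂ) • z k) (((a ^ 2 : ℝ) : ℂ) • T) := by
  refine ⟨?_, ?_⟩
  · simpa [norm_smul, mul_pow] using h.1.mul_left (a ^ 2)
  · refine hasSum_of_eq (h.2.const_smul ((a ^ 2 : ℝ) : ℂ)) fun k => ?_
    ext v
    simp only [InnerProductSpace.rankOne_apply, smul_apply, inner_smul_left, smul_smul,
      Complex.conj_ofReal]
    congr 1
    push_cast
    ring

/-- If a functional is not bounded on sums of rank-one operators, then there are arbitrarily small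
sums on which it takes the value one. -/
theorem exists_isKetbraSum_small {φ : TraceClass X →ₗ[ℂ] ℂ} {B : ℝ} (hB : 0 < B)
    (h : ∃ z T, IsKetbraSum z T ∧ B * ∑' k, ‖z k‖ ^ 2 < (φ T).re) :
    ∃ z T, IsKetbraSum z T ∧ (φ T).re = 1 ∧ ∑' k, ‖z k‖ ^ 2 ≤ B⁻¹ := by
  obtain ⟨z, T, hT, hlt⟩ := h
  have hS : 0 ≤ ∑' k, ‖z k‖ ^ 2 := tsum_nonneg fun _ => by positivity
  have hpos : 0 < (φ T).re := lt_of_le_of_lt (by positivity) hlt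
  have hsq : (√((φ T).re))⁻¹ ^ 2 = ((φ T).re)⁻¹ := by
    rw [inv_pow, Real.sq_sqrt hpos.le]
  refine ⟨_, _, hT.smul (√((φ T).re))⁻¹, ?_, ?_⟩
  · rw [map_smul, smul_eq_mul, Complex.re_ofReal_mul, hsq, inv_mul_cancel₀ hpos.ne']
  · have : ∀ k, ‖(((√((φ T).re))⁻¹ : ℝ) : ℂ) • z k‖ ^ 2 = ((φ T).re)⁻¹ * ‖z k‖ ^ 2 := by
      intro k
      rw [norm_smul, mul_pow, Complex.norm_real, Real.norm_eq_abs, sq_abs, hsq]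
    simp only [this]
    rw [tsum_mul_left, inv_mul_le_iff₀ hpos, ← div_eq_mul_inv, le_div_iff₀ hB]
    linarith

/-- A sum over pairs dominates the sums over finitely many rows. -/
theorem inner_sum_le_of_rows {z : ℕ → ℕ → X} {T : ℕ → TraceClass X}
    (hT : ∀ m, IsKetbraSum (z m) (T m)) {W : TraceClass X}
    (hW : IsKetbraSum (fun j => z (Nat.pairEquiv.symm j).1 (Nat.pairEquiv.symm j).2) W)
    (M : ℕ) (x : X) :
    ∑ m ∈ Finset.range M, ⟪x, (T m : X →L[ℂ] X) x⟫_ℂ ≤ ⟪x, (W : X →L[ℂ] X) x⟫_ℂ := by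
  have h1 : HasSum (fun p : ℕ × ℕ => ⟪x, z p.1 p.2⟫_ℂ * ⟪z p.1 p.2, x⟫_ℂ)
      ⟪x, (W : X →L[ℂ] X) x⟫_ℂ :=
    (Nat.pairEquiv.symm.hasSum_iff (f := fun p : ℕ × ℕ =>
      ⟪x, z p.1 p.2⟫_ℂ * ⟪z p.1 p.2, x⟫_ℂ)).1 (hW.hasSum_inner x)
  have h2 := h1.prod_fiberwise fun m => (hT m).hasSum_inner x
  exact sum_le_hasSum _ (fun m _ => (hT m).inner_nonneg x) h2

/-- Positive functionals on trace-class operators are bounded on sums of rank-one operators. -/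
theorem IsPositiveFunctional.exists_bound [CompleteSpace X] {φ : TraceClass X →ₗ[ℂ] ℂ}
    (hφ : IsPositiveFunctional φ) :
    ∃ C : ℝ, 0 ≤ C ∧ ∀ z T, IsKetbraSum z T → (φ T).re ≤ C * ∑' k, ‖z k‖ ^ 2 := by
  -- If unbounded, there are positive `T m` with `(φ (T m)).re = 1` and square sums at most `2⁻ᵐ`.
  -- Their total `W` is still trace-class and dominates each partial sum, so `(φ W).re ≥ M` for
  -- every `M`.
  by_contra! hcon
  choose z T hT hone hle using fun m : ℕ =>
    exists_isKetbraSum_small (by positivity : (0 : ℝ) < 2 ^ m) (hcon (2 ^ m) (by positivity))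
  have hgeom : Summable fun m : ℕ => ((2 : ℝ) ^ m)⁻¹ := by
    simpa [one_div, inv_pow] using summable_geometric_two
  have hsum : Summable fun p : ℕ × ℕ => ‖z p.1 p.2‖ ^ 2 := by
    refine (summable_prod_of_nonneg fun _ => by positivity).2 ⟨fun m => (hT m).1, ?_⟩
    exact Summable.of_nonneg_of_le (fun m => tsum_nonneg fun _ => by positivity) hle hgeom
  have hsum' : Summable fun j => ‖z (Nat.pairEquiv.symm j).1 (Nat.pairEquiv.symm j).2‖ ^ 2 :=
    (Nat.pairEquiv.symm.summable_iff (f := fun p : ℕ × ℕ => ‖z p.1 p.2‖ ^ 2)).2 hsum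
  obtain ⟨W, hW⟩ := exists_isKetbraSum hsum'
  have hbig : ∀ M : ℕ, (M : ℝ) ≤ (φ W).re := by
    intro M
    have hpos : 0 ≤ φ (W - ∑ m ∈ Finset.range M, T m) := by
      refine hφ _ fun x => ?_
      have h4 : ⟪x, ((W - ∑ m ∈ Finset.range M, T m : TraceClass X) : X →L[ℂ] X) x⟫_ℂ
          = ⟪x, (W : X →L[ℂ] X) x⟫_ℂ - ∑ m ∈ Finset.range M, ⟪x, (T m : X →L[ℂ] X) x⟫_ℂ := by
        rw [Submodule.coe_sub, Submodule.coe_sum, sub_apply, sum_apply, inner_sub_right, inner_sum]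
      rw [h4]
      exact sub_nonneg.2 (inner_sum_le_of_rows hT hW M x)
    rw [map_sub, map_sum] at hpos
    have h5 := (Complex.le_def.1 hpos).1
    rw [Complex.zero_re, Complex.sub_re, Complex.re_sum] at h5
    simp only [hone, Finset.sum_const, Finset.card_range, nsmul_eq_mul, mul_one] at h5
    linarith
  obtain ⟨M, hM⟩ := exists_nat_gt (φ W).re
  exact absurd (hbig M) (not_le.2 hM)

theorem isKetbraSum_ketbra (x : X) : IsKetbraSum (Pi.single 0 x) (ketbra x) := by
  refine ⟨?_, ?_⟩
  · refine summable_of_ne_finset_zero (s := {0}) fun k hk => ?_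
    have hk0 : k ≠ 0 := by simpa using hk
    simp [Pi.single_eq_of_ne hk0]
  · have h := hasSum_single (f := fun k => InnerProductSpace.rankOne ℂ
      ((Pi.single 0 x : ℕ → X) k) ((Pi.single 0 x : ℕ → X) k)) 0
      (fun k hk => by simp [Pi.single_eq_of_ne hk])
    rw [Pi.single_eq_same] at h
    exact h

theorem ketbra_inner_nonneg (x y : X) : 0 ≤ ⟪y, (ketbra x : X →L[ℂ] X) y⟫_ℂ :=
  (isKetbraSum_ketbra x).inner_nonneg y

theorem IsPositiveFunctional.exists_bound_ketbra [CompleteSpace X] {φ : TraceClass X →ₗ[ℂ] ℂ}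
    (hφ : IsPositiveFunctional φ) : ∃ C : ℝ, 0 ≤ C ∧ ∀ x, (φ (ketbra x)).re ≤ C * ‖x‖ ^ 2 := by
  obtain ⟨C, hC, h⟩ := hφ.exists_bound
  refine ⟨C, hC, fun x => (h _ _ (isKetbraSum_ketbra x)).trans_eq ?_⟩
  rw [tsum_eq_single 0 fun k hk => by simp [Pi.single_eq_of_ne hk]]
  simp

/-- Positive functionals on trace-class operators are countably additive. -/
theorem IsPositiveFunctional.hasSum [CompleteSpace X] {φ : TraceClass X →ₗ[ℂ] ℂ}
    (hφ : IsPositiveFunctional φ) {z : ℕ → X} {T : TraceClass X} (hT : IsKetbraSum z T) :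
    Filter.Tendsto (fun N => ∑ k ∈ Finset.range N, φ (ketbra (z k))) Filter.atTop
      (nhds (φ T)) := by
  obtain ⟨C, hC, hbound⟩ := hφ.exists_bound
  -- The remainder is again a sum of rank-one operators, so the bound controls it by a tail of `∑ ‖z
  -- k‖²`.
  have htail : ∀ N, IsKetbraSum (fun k => z (k + N)) (T - ∑ k ∈ Finset.range N, ketbra (z k)) := by
    intro N
    refine ⟨(summable_nat_add_iff N).2 hT.1, ?_⟩
    have h := (hasSum_nat_add_iff' N).2 hT.2
    have e : ((T - ∑ k ∈ Finset.range N, ketbra (z k) : TraceClass X) : X →L[ℂ] X)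
        = (T : X →L[ℂ] X) - ∑ k ∈ Finset.range N, InnerProductSpace.rankOne ℂ (z k) (z k) := by
      simp [ketbra]
    rw [e]
    exact h
  have hzero := tendsto_sum_nat_add fun k => ‖z k‖ ^ 2
  rw [tendsto_iff_norm_sub_tendsto_zero]
  refine squeeze_zero (fun _ => norm_nonneg _) (fun N => ?_) (by simpa using hzero.const_mul C)
  have hpos := hφ _ (htail N).inner_nonneg
  have hle := hbound _ _ (htail N)
  rw [← norm_neg, neg_sub, ← map_sum, ← map_sub]
  have hnorm : ‖φ (T - ∑ k ∈ Finset.range N, ketbra (z k))‖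
      = (φ (T - ∑ k ∈ Finset.range N, ketbra (z k))).re := by
    conv_rhs => rw [← Complex.norm_of_nonneg' hpos]
    rw [Complex.ofReal_re]
  rwa [hnorm]

theorem IsCP.positive {Λ : TraceClass X →ₗ[ℂ] TraceClass K} (hΛ : IsCP Λ) {T : TraceClass X}
    (hT : ∀ x, 0 ≤ ⟪x, (T : X →L[ℂ] X) x⟫_ℂ) (h : K) : 0 ≤ ⟪h, (Λ T : K →L[ℂ] K) h⟫_ℂ := by
  have := hΛ 1 (fun _ _ => T) (fun x => by simpa using hT (x 0)) fun _ => h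
  simpa using this

/-- The functional `T ↦ ⟨h|Λ(T)|h⟩`. -/
noncomputable def expectation (Λ : TraceClass X →ₗ[ℂ] TraceClass K) (h h' : K) :
    TraceClass X →ₗ[ℂ] ℂ :=
  (innerSL ℂ h).toLinearMap ∘ₗ (ContinuousLinearMap.apply ℂ K h').toLinearMap ∘ₗ
    (TraceClass K).subtype ∘ₗ Λ

theorem expectation_apply (Λ : TraceClass X →ₗ[ℂ] TraceClass K) (h h' : K) (T : TraceClass X) :
    expectation Λ h h' T = ⟪h, (Λ T : K →L[ℂ] K) h'⟫_ℂ := rfl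

theorem IsCP.isPositiveFunctional {Λ : TraceClass X →ₗ[ℂ] TraceClass K} (hΛ : IsCP Λ) (h : K) :
    IsPositiveFunctional (expectation Λ h h) := fun _ hT => hΛ.positive hT h

theorem outer_smul_left (a : ℂ) (x y : X) : outer (a • y) x = star a • outer y x := by
  ext v
  simp [coe_outer, smul_smul]

/-- Positivity of the kernel `⟨h|Λ(|x⟩⟨x'|)|h'⟩` of a completely positive map. -/
theorem IsCP.posSemidef {Λ : TraceClass X →ₗ[ℂ] TraceClass K} (hΛ : IsCP Λ) (x : Fin 2 → X)
    (h : Fin 2 → K) :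
    (Matrix.of fun i j => ⟪h i, (Λ (outer (x j) (x i)) : K →L[ℂ] K) (h j)⟫_ℂ).PosSemidef := by
  have hpos : ∀ a : Fin 2 → ℂ, 0 ≤ star a ⬝ᵥ
      (Matrix.of fun i j => ⟪h i, (Λ (outer (x j) (x i)) : K →L[ℂ] K) (h j)⟫_ℂ).mulVec a := by
    intro a
    -- The block operator `(|x_i⟩⟨x_j|)` is positive because its quadratic form is `|∑ ⟨y_i|x_i⟩|²`.
    have h1 := hΛ 2 (fun i j => outer (x j) (x i)) (fun y => ?_) fun i => a i • h i
    · simp only [map_smul, inner_smul_left, inner_smul_right] at h1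
      convert h1 using 1
      simp only [dotProduct, Matrix.mulVec, Matrix.of_apply, Finset.mul_sum, Pi.star_apply]
      refine Finset.sum_congr rfl fun i _ => Finset.sum_congr rfl fun j _ => ?_
      rw [RCLike.star_def]
      ring
    · have : ∑ i, ∑ j, ⟪y i, (outer (x j) (x i) : X →L[ℂ] X) (y j)⟫_ℂ
          = (∑ i, ⟪y i, x i⟫_ℂ) * star (∑ i, ⟪y i, x i⟫_ℂ) := by
        rw [star_sum, Finset.sum_mul_sum]
        refine Finset.sum_congr rfl fun i _ => Finset.sum_congr rfl fun j _ => ?_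
        rw [coe_outer, InnerProductSpace.rankOne_apply, inner_smul_right, RCLike.star_def,
          inner_conj_symm, mul_comm]
      rw [this]
      exact mul_star_self_nonneg _
  rw [← Matrix.isPositive_toEuclideanLin_iff, LinearMap.isPositive_iff_complex]
  intro a
  have h2 : 0 ≤ ⟪a, Matrix.toEuclideanLin (Matrix.of fun i j =>
      ⟪h i, (Λ (outer (x j) (x i)) : K →L[ℂ] K) (h j)⟫_ℂ) a⟫_ℂ := by
    rw [EuclideanSpace.inner_eq_star_dotProduct, dotProduct_comm]
    exact hpos _
  rw [← inner_conj_symm]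
  rw [Complex.eq_re_of_ofReal_le h2]
  simpa using (Complex.le_def.1 h2).1

theorem IsCP.conj_inner {Λ : TraceClass X →ₗ[ℂ] TraceClass K} (hΛ : IsCP Λ) (x x' : X)
    (h h' : K) :
    star ⟪h, (Λ (outer x' x) : K →L[ℂ] K) h'⟫_ℂ = ⟪h', (Λ (outer x x') : K →L[ℂ] K) h⟫_ℂ :=
  (hΛ.posSemidef ![x', x] ![h', h]).isHermitian.apply 0 1

/-- Nonnegativity of the determinant of the `2 × 2` kernel. It transfers information from the
diagonal values `Λ(|x⟩⟨x|)` to the off-diagonal ones. -/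
theorem IsCP.normSq_inner_le {Λ : TraceClass X →ₗ[ℂ] TraceClass K} (hΛ : IsCP Λ) (x x' : X)
    (h h' : K) :
    ‖⟪h, (Λ (outer x' x) : K →L[ℂ] K) h'⟫_ℂ‖ ^ 2 ≤
      (⟪h, (Λ (ketbra x) : K →L[ℂ] K) h⟫_ℂ).re * (⟪h', (Λ (ketbra x') : K →L[ℂ] K) h'⟫_ℂ).re := by
  have hdet := (hΛ.posSemidef ![x, x'] ![h, h']).det_nonneg
  rw [Matrix.det_fin_two] at hdet
  have h1 := hΛ.positive (ketbra_inner_nonneg x) h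
  have h2 := hΛ.positive (ketbra_inner_nonneg x') h'
  have h3 := hΛ.conj_inner x x' h h'
  have e1 := Complex.eq_re_of_ofReal_le h1
  have e2 := Complex.eq_re_of_ofReal_le h2
  simp only [Matrix.of_apply, Matrix.cons_val_zero, Matrix.cons_val_one, ← ketbra_eq_outer] at hdet
  rw [← h3, RCLike.star_def, Complex.mul_conj, Complex.normSq_eq_norm_sq] at hdet
  rw [e1, e2] at hdet
  exact_mod_cast sub_nonneg.1 hdet

/-- A completely positive map is determined by its values on the operators `|x⟩⟨x|`. -/
theorem IsCP.ext_ketbra [CompleteSpace X] {Λ Λ' : TraceClass X →ₗ[ℂ] TraceClass K} (hΛ : IsCP Λ)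
    (hΛ' : IsCP Λ') (s : ℂ) (h : ∀ x, Λ' (ketbra x) = s • Λ (ketbra x)) : Λ' = s • Λ := by
  -- Over `ℂ` an operator is determined by its expectation values, and these are countably additive
  -- in `T`.
  have htop := eq_top_of_isKetbraSum_mem (P := LinearMap.eqLocus Λ' (s • Λ)) fun z T hT => ?_
  · ext1 T
    have : T ∈ LinearMap.eqLocus Λ' (s • Λ) := htop ▸ Submodule.mem_top
    exact this
  · change Λ' T = s • Λ T
    ext1
    refine ContinuousLinearMap.coe_inj.1 ((ext_inner_map _ _).1 fun v => ?_)
    have h1 := (hΛ'.isPositiveFunctional v).hasSum hT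
    have h2 := ((hΛ.isPositiveFunctional v).hasSum hT).const_mul s
    have h3 : expectation Λ' v v T = s * expectation Λ v v T := by
      refine tendsto_nhds_unique h1 (h2.congr fun N => ?_)
      rw [Finset.mul_sum]
      refine Finset.sum_congr rfl fun k _ => ?_
      simp [expectation_apply, h]
    simp only [expectation_apply] at h3
    rw [← inner_conj_symm, ← inner_conj_symm _ v]
    simp [h3, inner_smul_right]

end Positivity

/-! ### Uniqueness: from the superposition property to a multiple of the conjugation. -/

section Uniqueness

variable {H : Type*} [NormedAddCommGroup H] [InnerProductSpace ℂ H] {ι : Type*} {n : ℕ}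

theorem exists_orthogonal_ne_zero (χ : H) (h : 2 ≤ Module.rank ℂ H) :
    ∃ ξ : H, ξ ≠ 0 ∧ ⟪χ, ξ⟫_ℂ = 0 := by
  by_contra! hcon
  have htop : (⊤ : Submodule ℂ H) = Submodule.span ℂ {χ} := by
    have hbot : (Submodule.span ℂ {χ})ᗮ = ⊥ := by
      refine eq_bot_iff.2 fun ξ hξ => ?_
      by_contra h0
      exact hcon ξ h0 (Submodule.mem_orthogonal_singleton_iff_inner_right.1 hξ)
    exact ((Submodule.orthogonal_eq_bot_iff).1 hbot).symm
  have h1 : Module.rank ℂ H ≤ 1 := by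
    rw [← rank_top ℂ H, htop]
    exact (rank_span_le _).trans (by simp)
  exact absurd (h.trans h1) (by norm_num)

/-- The radius solves `c (1 + t²) = 1`, so `√c (χ + ξ)` is a unit vector with overlap `√c`. Strict
inequality `c < 1` makes the radius positive. -/
theorem isInput_of_latitude {χ : H} (hχ : ‖χ‖ = 1) {c : Fin (n + 1) → ℝ} (hc : ∀ i, 0 < c i)
    (hc1 : ∀ i, c i < 1) {α : EuclideanSpace ℂ (Fin (n + 1))} (hα : ‖α‖ = 1)
    {ψ : Fin (n + 1) → H} (hψ : ∀ k, ψ k ∈ latitude χ √((1 - c k) / c k)) :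
    IsInput χ c α fun k => ((√(c k) : ℝ) : ℂ) • ψ k := by
  refine ⟨hα, fun i => ⟨?_, ?_⟩⟩
  · have hpyth : ‖ψ i‖ ^ 2 = 1 + (1 - c i) / c i := by
      have h := norm_add_sq_eq_norm_sq_add_norm_sq_of_inner_eq_zero χ (ψ i - χ) (hψ i).1
      rw [add_sub_cancel, hχ, (hψ i).2, Real.mul_self_sqrt] at h
      · rw [sq, h, one_mul]
      · exact div_nonneg (sub_nonneg.2 (hc1 i).le) (hc i).le
    have h1 : (√(c i) * ‖ψ i‖) ^ 2 = 1 := by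
      have := (hc i).ne'
      rw [mul_pow, Real.sq_sqrt (hc i).le, hpyth]
      field_simp
      ring
    rw [norm_smul, Complex.norm_real, Real.norm_of_nonneg (Real.sqrt_nonneg _)]
    exact (pow_eq_one_iff_of_nonneg (by positivity) two_ne_zero).1 h1
  · rw [inner_smul_right, inner_of_mem_latitude hχ (hψ i), mul_one, Complex.norm_real,
      Real.norm_of_nonneg (Real.sqrt_nonneg _), Real.sq_sqrt (hc i).le]

theorem superposition_of_latitude {χ : H} (hχ : ‖χ‖ = 1) {c t : Fin (n + 1) → ℝ}
    (hc : ∀ i, 0 < c i) {α : EuclideanSpace ℂ (Fin (n + 1))} {ψ : Fin (n + 1) → H}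
    (hψ : ∀ k, ψ k ∈ latitude χ (t k)) :
    superposition χ α (fun k => ((√(c k) : ℝ) : ℂ) • ψ k)
      = ∑ i, (α i * ((√(c i) : ℝ) : ℂ)) • ψ i := by
  refine Finset.sum_congr rfl fun i _ => ?_
  have h1 : ∀ k, ⟪χ, ((√(c k) : ℝ) : ℂ) • ψ k⟫_ℂ = ((√(c k) : ℝ) : ℂ) := fun k => by
    rw [inner_smul_right, inner_of_mem_latitude hχ (hψ k), mul_one]
  have h2 : (∏ k ∈ Finset.univ.erase i, ((√(c k) : ℝ) : ℂ)) ≠ 0 :=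
    Finset.prod_ne_zero_iff.2 fun k _ =>
      Complex.ofReal_ne_zero.2 (Real.sqrt_pos.2 (hc k)).ne'
  have h3 : ((∏ k ∈ Finset.univ.erase i, ‖⟪χ, ((√(c k) : ℝ) : ℂ) • ψ k⟫_ℂ‖ : ℝ) : ℂ)
      = ∏ k ∈ Finset.univ.erase i, ((√(c k) : ℝ) : ℂ) := by
    rw [Complex.ofReal_prod]
    refine Finset.prod_congr rfl fun k _ => ?_
    rw [h1, Complex.norm_real, Real.norm_of_nonneg (Real.sqrt_nonneg _)]
  rw [h3]
  simp only [h1]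
  rw [div_self h2, mul_one, smul_smul]

theorem exists_eq_smul_of_orthogonal {v w : H} (h : ∀ u : H, ⟪u, v⟫_ℂ = 0 → ⟪u, w⟫_ℂ = 0) :
    ∃ s : ℂ, w = s • v := by
  have hw : w ∈ (Submodule.span ℂ {v})ᗮᗮ := by
    rw [Submodule.mem_orthogonal]
    intro u hu
    exact h u (Submodule.mem_orthogonal_singleton_iff_inner_left.1 hu)
  rw [Submodule.orthogonal_orthogonal] at hw
  obtain ⟨s, hs⟩ := Submodule.mem_span_singleton.1 hw
  exact ⟨s, hs.symm⟩

variable [CompleteSpace H]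

/-- A linear map that sends every admissible product vector to a multiple of the superposition
agrees on product vectors with a multiple of the contraction. -/
theorem exists_eq_smul_contraction_pureTensor (b : HilbertBasis ι ℂ H) {χ ξ : H} (hχ : ‖χ‖ = 1)
    (hξ : ξ ≠ 0) (hχξ : ⟪χ, ξ⟫_ℂ = 0) {c : Fin (n + 1) → ℝ} (hc : ∀ i, 0 < c i)
    (hc1 : ∀ i, c i < 1) (M : Space ι n →ₗ[ℂ] H)
    (hM : ∀ α ψ, IsInput χ c α ψ → ∃ s : ℂ, M (pureTensor b α ψ) = s • superposition χ α ψ) :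
    ∃ m : ℂ, ∀ i ψ, M (pureTensor b (EuclideanSpace.single i 1) ψ)
      = m • contraction b n χ (muVec c) (pureTensor b (EuclideanSpace.single i 1) ψ) := by
  have hsq : ∀ k, ((√(c k) : ℝ) : ℂ) ≠ 0 := fun k =>
    Complex.ofReal_ne_zero.2 (Real.sqrt_pos.2 (hc k)).ne'
  have hprod : (∏ k, ((√(c k) : ℝ) : ℂ)) ≠ 0 := Finset.prod_ne_zero_iff.2 fun k _ => hsq k
  obtain ⟨m, hm⟩ := multilinear_superposition hχ hξ hχξ (t := fun k => √((1 - c k) / c k))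
    (fun k => Real.sqrt_pos.2 (div_pos (sub_pos.2 (hc1 k)) (hc k)))
    -- The superposition of the rescaled inputs carries an extra weight `√(c i)` on `ψ i`, which
    -- this factor cancels.
    (fun i => ((√(c i) : ℝ) : ℂ)⁻¹ •
      M.compMultilinearMap (pureTensorMultilinear b (EuclideanSpace.single i 1)))
    (fun ψ hψ β => by
      obtain ⟨ν, hν⟩ : ∃ ν : EuclideanSpace ℂ (Fin (n + 1)),
        ∀ i, ν i = β i * ((√(c i) : ℝ) : ℂ)⁻¹ := ⟨WithLp.toLp 2 fun i => _, fun i => rfl⟩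
      have hlhs : ∑ i, β i • (((√(c i) : ℝ) : ℂ)⁻¹ •
          M.compMultilinearMap (pureTensorMultilinear b (EuclideanSpace.single i 1))) ψ
          = M (pureTensor b ν ψ) := by
        rw [pureTensor_eq_sum, map_sum]
        refine Finset.sum_congr rfl fun i _ => ?_
        rw [smul_apply, LinearMap.compMultilinearMap_apply, pureTensorMultilinear_apply,
          smul_smul, map_smul, hν]
      rw [hlhs]
      -- Admissible inputs need a unit qudit vector, so `ν` is normalized, with zero treated apart.
      by_cases hν0 : ν = 0
      · refine ⟨0, ?_⟩
        have : pureTensor b ν ψ = 0 := by rw [hν0, pureTensor_eq_sum]; simp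
        rw [this, map_zero, zero_smul]
      have hn : ((‖ν‖ : ℝ) : ℂ) ≠ 0 := Complex.ofReal_ne_zero.2 (norm_ne_zero_iff.2 hν0)
      have hunit : ‖((‖ν‖ : ℝ) : ℂ)⁻¹ • ν‖ = 1 := by
        rw [norm_smul, norm_inv, Complex.norm_real, norm_norm]
        exact inv_mul_cancel₀ (norm_ne_zero_iff.2 hν0)
      obtain ⟨s, hs⟩ := hM _ _ (isInput_of_latitude hχ hc hc1 hunit hψ)
      rw [superposition_of_latitude hχ hc hψ, pureTensor_smul_factors, pureTensor_smul, map_smul,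
        map_smul] at hs
      have hrhs : ∑ i, ((((‖ν‖ : ℝ) : ℂ)⁻¹ • ν) i * ((√(c i) : ℝ) : ℂ)) • ψ i
          = ((‖ν‖ : ℝ) : ℂ)⁻¹ • ∑ i, β i • ψ i := by
        rw [Finset.smul_sum]
        refine Finset.sum_congr rfl fun i _ => ?_
        rw [PiLp.smul_apply, hν, smul_smul, smul_eq_mul, mul_assoc, mul_assoc,
          inv_mul_cancel₀ (hsq i), mul_one]
      rw [hrhs, smul_comm s, smul_comm (∏ k, _)] at hs
      have hs' := smul_right_injective H (inv_ne_zero hn) hs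
      refine ⟨(∏ k, ((√(c k) : ℝ) : ℂ))⁻¹ * s, ?_⟩
      rw [mul_smul, ← hs', smul_smul, inv_mul_cancel₀ hprod, one_smul])
  obtain ⟨N, hN0, -, hN⟩ := exists_muVec_apply hc
  have hN0' : (N : ℂ) ≠ 0 := Complex.ofReal_ne_zero.2 hN0.ne'
  -- The ratio of `√(c i)` to `N / ∏_{k ≠ i} √(c k)` does not depend on `i`: the product over `k ≠
  -- i` is completed by the factor `√(c i)`.
  refine ⟨m * (∏ k, ((√(c k) : ℝ) : ℂ)) * (N : ℂ)⁻¹, fun i ψ => ?_⟩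
  have h := congrArg (fun v => ((√(c i) : ℝ) : ℂ) • v) (hm i ψ)
  simp only [smul_apply, LinearMap.compMultilinearMap_apply, pureTensorMultilinear_apply,
    smul_smul, mul_inv_cancel₀ (hsq i), one_smul] at h
  rw [h, contraction_pureTensor_single, hN, smul_smul]
  congr 1
  have he : (∏ k ∈ Finset.univ.erase i, ((√(c k) : ℝ) : ℂ)) ≠ 0 :=
    Finset.prod_ne_zero_iff.2 fun k _ => hsq k
  rw [← Finset.mul_prod_erase _ _ (Finset.mem_univ i), RCLike.star_def, Complex.conj_ofReal,
    Complex.ofReal_mul, Complex.ofReal_inv, Complex.ofReal_prod]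
  field_simp

/-- A completely positive map with the superposition property, applied to `|x⟩⟨y|`, is determined
up to a scalar by `y`. -/
theorem exists_apply_outer_eq_smul_contraction (b : HilbertBasis ι ℂ H) {χ ξ : H} (hχ : ‖χ‖ = 1)
    (hξ : ξ ≠ 0) (hχξ : ⟪χ, ξ⟫_ℂ = 0) {c : Fin (n + 1) → ℝ} (hc : ∀ i, 0 < c i)
    (hc1 : ∀ i, c i < 1) {Λ : TraceClass (Space ι n) →ₗ[ℂ] TraceClass H} (hΛ : IsCP Λ)
    (hsup : ∀ α ψ, IsInput χ c α ψ → ∃ r : ℝ,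
      Λ (ketbra (pureTensor b α ψ)) = (r : ℂ) • ketbra (superposition χ α ψ))
    (y : Space ι n) (h' : H) :
    ∃ m : ℂ, ∀ x, (Λ (outer y x) : H →L[ℂ] H) h' = m • contraction b n χ (muVec c) x := by
  let M : Space ι n →ₗ[ℂ] H := (ContinuousLinearMap.apply ℂ H h').toLinearMap ∘ₗ
    (TraceClass H).subtype ∘ₗ Λ ∘ₗ outer y
  have hM : ∀ x, M x = (Λ (outer y x) : H →L[ℂ] H) h' := fun _ => rfl
  obtain ⟨m, hm⟩ := exists_eq_smul_contraction_pureTensor b hχ hξ hχξ hc hc1 M fun α ψ hin => by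
    obtain ⟨r, hr⟩ := hsup α ψ hin
    -- For `u` orthogonal to the superposition the diagonal factor in Cauchy–Schwarz vanishes.
    refine exists_eq_smul_of_orthogonal fun u hu => ?_
    have hle := hΛ.normSq_inner_le (pureTensor b α ψ) y u h'
    have hzero : ⟪u, (Λ (ketbra (pureTensor b α ψ)) : H →L[ℂ] H) u⟫_ℂ = 0 := by
      rw [hr]
      simp [ketbra, hu]
    rw [hzero, Complex.zero_re, zero_mul] at hle
    rw [hM]
    exact norm_eq_zero.1 (pow_eq_zero_iff two_ne_zero |>.1 (le_antisymm hle (sq_nonneg _)))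
  refine ⟨m, fun x => ext_inner_left ℂ fun u => ?_⟩
  obtain ⟨C, hC, hbound⟩ := (hΛ.isPositiveFunctional u).exists_bound_ketbra
  have hD := (Complex.le_def.1 (hΛ.positive (ketbra_inner_nonneg y) h')).1
  rw [Complex.zero_re] at hD
  -- `M` is only known to be linear. Cauchy–Schwarz and the bound on `⟨u|Λ(|x⟩⟨x|)|u⟩` make `⟨u|M
  -- x⟩` continuous, so product vectors suffice.
  let f : Space ι n →L[ℂ] ℂ := LinearMap.mkContinuous ((innerSL ℂ u).toLinearMap ∘ₗ M)
    √(C * (⟪h', (Λ (ketbra y) : H →L[ℂ] H) h'⟫_ℂ).re) fun x => by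
      refine abs_le_of_sq_le_sq' ?_ (by positivity) |>.2
      rw [mul_pow, Real.sq_sqrt (mul_nonneg hC hD)]
      calc _ ≤ _ := hΛ.normSq_inner_le x y u h'
        _ ≤ C * ‖x‖ ^ 2 * _ := mul_le_mul_of_nonneg_right (hbound x) hD
        _ = _ := by ring
  have hf : f = innerSL ℂ u ∘L (m • contraction b n χ (muVec c)) := by
    refine ext_pureTensor b fun i ψ => ?_
    change ⟪u, M _⟫_ℂ = ⟪u, m • contraction b n χ (muVec c) _⟫_ℂ
    rw [hm]
  exact congrArg (fun g : Space ι n →L[ℂ] ℂ => g x) hf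

theorem exists_contraction_ne_zero (b : HilbertBasis ι ℂ H) {χ : H} (hχ : ‖χ‖ = 1)
    {c : Fin (n + 1) → ℝ} (hc : ∀ i, 0 < c i) : ∃ x, contraction b n χ (muVec c) x ≠ 0 := by
  obtain ⟨N, hN0, -, hN⟩ := exists_muVec_apply hc
  refine ⟨pureTensor b (EuclideanSpace.single 0 1) fun _ => χ, ?_⟩
  rw [contraction_pureTensor_single, hN, inner_self_eq_norm_sq_to_K, hχ]
  have hp : 0 < ∏ k ∈ Finset.univ.erase (0 : Fin (n + 1)), √(c k) :=
    Finset.prod_pos fun k _ => Real.sqrt_pos.2 (hc k)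
  refine smul_ne_zero (mul_ne_zero ?_ (by simp)) (norm_ne_zero_iff.1 (by simp [hχ]))
  rw [RCLike.star_def, Complex.conj_ofReal]
  exact Complex.ofReal_ne_zero.2 (by positivity)

/-- A completely positive map of the form `|x⟩⟨y| ↦ |Ax⟩⟨m(y)|` is a nonnegative multiple of
`T ↦ A T A†`. -/
theorem IsCP.eq_smul_conjugation {X K : Type*} [NormedAddCommGroup X] [InnerProductSpace ℂ X]
    [NormedAddCommGroup K] [InnerProductSpace ℂ K] [CompleteSpace X] [CompleteSpace K]
    {Λ : TraceClass X →ₗ[ℂ] TraceClass K} (hΛ : IsCP Λ) {A : X →L[ℂ] K} {x₁ : X} (hA : A x₁ ≠ 0)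
    (h : ∀ y h', ∃ m : ℂ, ∀ x, (Λ (outer y x) : K →L[ℂ] K) h' = m • A x) :
    ∃ s : ℝ, 0 ≤ s ∧ Λ = (s : ℂ) • conjugation A := by
  choose m hm using h
  have hq : ⟪A x₁, A x₁⟫_ℂ ≠ 0 := inner_self_ne_zero.2 hA
  have hq0 : 0 < ⟪A x₁, A x₁⟫_ℂ := lt_of_le_of_ne
    (by rw [inner_self_eq_norm_sq_to_K, ← RCLike.ofReal_pow]
        exact Complex.zero_le_real.2 (sq_nonneg _)) hq.symm
  -- Hermitian symmetry exchanges `(x₁, A x₁)` with `(y, h')` and expresses `m y h'` through the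
  -- single number `m x₁ (A x₁)`.
  obtain ⟨s, hs⟩ : ∃ s : ℂ, ∀ y h', m y h' = s * ⟪A y, h'⟫_ℂ := by
    refine ⟨star (m x₁ (A x₁)) / ⟪A x₁, A x₁⟫_ℂ, fun y h' => ?_⟩
    have h1 := hΛ.conj_inner x₁ y (A x₁) h'
    rw [hm, hm, inner_smul_right, inner_smul_right] at h1
    have h2 := congrArg star h1
    rw [star_star, star_mul', RCLike.star_def, inner_conj_symm] at h2
    rw [div_mul_eq_mul_div, eq_div_iff hq, h2, RCLike.star_def]
  have hpos := hΛ.positive (ketbra_inner_nonneg x₁) (A x₁)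
  rw [ketbra_eq_outer, hm, hs, inner_smul_right] at hpos
  have hs0 : 0 ≤ s := by
    have h3 : s = (s * ⟪A x₁, A x₁⟫_ℂ * ⟪A x₁, A x₁⟫_ℂ) *
        ((⟪A x₁, A x₁⟫_ℂ)⁻¹ * (⟪A x₁, A x₁⟫_ℂ)⁻¹) := by field_simp
    rw [h3]
    have h4 := inv_nonneg.2 hq0.le
    exact mul_nonneg hpos (mul_nonneg h4 h4)
  refine ⟨s.re, (Complex.le_def.1 hs0).1, ?_⟩
  rw [← Complex.eq_re_of_ofReal_le hs0]
  refine (isCP_conjugation A).ext_ketbra hΛ s fun x => ?_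
  ext1
  ext1 v
  rw [ketbra_eq_outer, conjugation_outer, hm, hs, Submodule.coe_smul, smul_apply, coe_outer,
    InnerProductSpace.rankOne_apply, smul_smul]

end Uniqueness

end Superposition

open Superposition in
theorem theorem3 {H : Type*} [NormedAddCommGroup H] [InnerProductSpace ℂ H] [CompleteSpace H]
    {ι : Type*} (b : HilbertBasis ι ℂ H) (n : ℕ) (hn : 1 < n + 1)
    (χ : H) (hχ : ‖χ‖ = 1) (c : Fin (n + 1) → ℝ) (hc : ∀ i, 0 < c i) :
    ∃ Λ : TraceClass (Space ι n) →ₗ[ℂ] TraceClass H,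
      IsCP Λ ∧ IsProtocol b χ c Λ ∧
      (∃ r : ℝ, 0 < r ∧ ∀ α ψ, IsInput χ c α ψ →
        Λ (ketbra (pureTensor b α ψ)) = (r : ℂ) • ketbra (superposition χ α ψ)) ∧
      ((∀ i, c i < 1) → 2 ≤ Module.rank ℂ H →
        ∀ Λ' : TraceClass (Space ι n) →ₗ[ℂ] TraceClass H, IsCP Λ' →
          (∀ α ψ, IsInput χ c α ψ → ∃ r : ℝ,
            Λ' (ketbra (pureTensor b α ψ)) = (r : ℂ) • ketbra (superposition χ α ψ)) →
          ∃ s : ℝ, 0 ≤ s ∧ Λ' = (s : ℂ) • Λ) := by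
  obtain ⟨N, hN0, hμ, hN⟩ := exists_muVec_apply hc
  -- The constant is `r = N²`, as the contraction multiplies the superposition by `N`.
  refine ⟨conjugation (contraction b n χ (muVec c)), isCP_conjugation _,
    fun T => isPartialTrace_contraction b hχ hμ T, ⟨N * N, by positivity, fun α ψ h => ?_⟩, ?_⟩
  · rw [ketbra_eq_outer, conjugation_outer, contraction_pureTensor_of_isInput b hN h,
      outer_smul_left, map_smul, smul_smul, ketbra_eq_outer]
    simp
  · intro hc1 hrank Λ' hΛ' hsup
    obtain ⟨ξ, hξ, hχξ⟩ := exists_orthogonal_ne_zero χ hrank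
    obtain ⟨x₁, hx₁⟩ := exists_contraction_ne_zero b hχ hc (n := n)
    exact hΛ'.eq_smul_conjugation hx₁ fun y h' =>
      exists_apply_outer_eq_smul_contraction b hχ hξ hχξ hc hc1 hΛ' hsup y h'
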